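/- Let $T$ be a string of length $n$ over an integer alphabet $\{1,\dots,n^{d}\}$ ($d$ a constant) whose last character is the smallest character $\$=1$, which occurs nowhere else in $T$; let $r$ be the number of maximal runs of equal characters in the Burrows–Wheeler transform (BWT) of $T$, and let $\alpha\ge 16$ be an integer. *The algorithm r-comp.* It reads $T$ from right to left and, for $\delta=1,\dots,n$, maintains a divided BWT (DBWT) $D$ of the suffix $T_\delta$ of length $\delta$: a division of its BWT $L$ into repetitions of equal characters starting at positions $p_1<\dots<p_k$. The LF function $\mathsf{LF}(i)=|\{j: L[j]<L[i]\}|+|\{j\le i: L[j]=L[i]\}|$ maps the $i$-th repetition to an interval, its F-interval. A repetition (F-interval) is $\alpha$-heavy if, as an interval of positions, it contains at least $\alpha$ starting positions of F-intervals (of repetitions). Initially $D=(\$)$. For the next character $c$, let $\mathsf{rep}$ be the position of $\$$ in $L$ and $\mathsf{ins}=|\{j: L[j]<c\}|+|\{j\le\mathsf{rep}:L[j]=c\}|+1$. The update replaces the repetition $\$$ by $c$, splits at $\mathsf{ins}$ the repetition that contains $\mathsf{ins}$ but does not start there (if there is one), and inserts the repetition $\$$ at position $\mathsf{ins}$. If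 a repetition adjacent to the old $\$$ consists of $c$'s, then the new repetition $c$ is merged with neighbouring repetitions of $c$'s: if both neighbours are such, with both if the previous update split a repetition and with the left one only if it did not; otherwise with the one neighbour that is. Then, as long as there is an $\alpha$-heavy repetition or F-interval, an arbitrary one is chosen and split: if the $i$-th repetition is $\alpha$-heavy and $q_0<\dots<q_{t-1}$ are the starting positions of F-intervals that it contains, it is split at $q_{\lceil t/2\rceil}$; if it is not $\alpha$-heavy but its F-interval is, and $q_0<\dots<q_{t-1}$ are the starting positions of repetitions that the F-interval contains, the repetition is split at $p_i+q_{\lceil t/2\rceil}-\mathsf{LF}(p_i)$. After all characters have been read, $D$ is converted into the run-length encoding of the BWT of $T$. *Working space.* The algorithm runs on a word RAM with words of $w=\Theta(\log n)$ bits, $w\ge K\log_2 n$ for a constant $K$ depending only on $d$. It stores $D$ as its LF-interval graph: two doubly linked lists, one of the repetitions and one of the F-intervals in the order of their starting positions, where each node holds its label (character, length), a pointer to the corresponding node of the other list, a pointer to the node of the other list whose interval contains its starting position, and the offset in that interval; moreover, two arrays of the $\alpha$-heavy nodes, an order-maintenance structure (a tagged list of tagged groups) on the repetitions, a B-tree of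 constant order on F-intervals, a constant number of local variables, and at the end the list $D$ and the output. The read-only input is not counted. Then the following holds. 1. There is an absolute constant $C_0$ such that the final number $k$ of repetitions of $D$ is at most $C_0\, r$. 2. For $n\ge 2$, at every time during the execution all values stored fit into machine words and the number of bits in use is at most $C\, r\log_2 n$, where $C$ depends only on $d$, on the constant in $w=O(\log n)$, on the order of the B-tree and on the number of local variables, but not on $T$, $n$ or $\alpha$. That is, for $\alpha\ge 16$, r-comp uses $O(r\log n)$ bits of working space, and $k=O(r)$. -/

import Mathlib

/-! Strings are lists of natural numbers; positions are counted from `0`. -/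

namespace RComp

/-! ### Strings, BWT, runs -/

/-- The special character, the smallest character of the alphabet `{1, 2, ...}`. -/
def dollar : ℕ := 1

/-- `T` ends with the special character, which occurs nowhere else in `T`. -/
def IsText (T : List ℕ) : Prop :=
  ∃ S : List ℕ, T = S ++ [dollar] ∧ ∀ c ∈ S, dollar < c

/-- Starting positions of the suffixes of `T` in lexicographic order of the suffixes. -/
def suffixArray (T : List ℕ) : List ℕ :=
  (List.range T.length).mergeSort fun i j => decide (T.drop i ≤ T.drop j)

/-- The Burrows-Wheeler transform: the characters that precede the sorted suffixes, where the last
character of `T` precedes the suffix starting at position `0`. -/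
def bwt (T : List ℕ) : List ℕ :=
  (suffixArray T).map fun i => if i = 0 then T.getD (T.length - 1) 0 else T.getD (i - 1) 0

/-- The number `r` of maximal runs of equal characters in the BWT of `T`. -/
def numRuns (T : List ℕ) : ℕ := ((bwt T).splitBy (· == ·)).length

/-- Number of characters of `L` smaller than `c`. -/
def occLt (L : List ℕ) (c : ℕ) : ℕ := L.countP fun x => decide (x < c)

/-- Number of occurrences of `c` among the first `i` characters of `L`. -/
def rank (L : List ℕ) (c i : ℕ) : ℕ := (L.take i).count c

/-- The LF formula, for positions counted from `0`. -/
def lf (L : List ℕ) (i : ℕ) : ℕ := occLt L (L.getD i 0) + rank L (L.getD i 0) i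

/-! ### Divided BWTs -/

/-- A divided BWT is stored as the sequence of the labels (character, length) of its repetitions. -/
abbrev DBWT := List (ℕ × ℕ)

/-- The string represented by a sequence of repetitions. -/
def expand (D : DBWT) : List ℕ := D.flatMap fun x => List.replicate x.2 x.1

def char (D : DBWT) (i : ℕ) : ℕ := (D.getD i (0, 0)).1

def len (D : DBWT) (i : ℕ) : ℕ := (D.getD i (0, 0)).2

/-- Starting position of the `i`-th repetition. -/
def uStart (D : DBWT) (i : ℕ) : ℕ := ((D.take i).map Prod.snd).sum

/-- Starting position of the F-interval of the `i`-th repetition. The F-interval has the length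
of the repetition, since LF maps a repetition to consecutive positions. -/
def vStart (D : DBWT) (i : ℕ) : ℕ := lf (expand D) (uStart D i)

/-- The starting positions of F-intervals covered by the `i`-th repetition, in increasing order. -/
def coveredByU (D : DBWT) (i : ℕ) : List ℕ :=
  (((List.range D.length).map (vStart D)).filter fun x =>
    decide (uStart D i ≤ x ∧ x < uStart D i + len D i)).mergeSort

/-- The starting positions of repetitions covered by the `i`-th F-interval, in increasing order. -/
def coveredByV (D : DBWT) (i : ℕ) : List ℕ :=
  (((List.range D.length).map (uStart D)).filter fun x =>
    decide (vStart D i ≤ x ∧ x < vStart D i + len D i)).mergeSort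

/-- The `i`-th repetition is `α`-heavy. -/
def HeavyU (α : ℕ) (D : DBWT) (i : ℕ) : Prop := i < D.length ∧ α ≤ (coveredByU D i).length

/-- The `i`-th F-interval is `α`-heavy. -/
def HeavyV (α : ℕ) (D : DBWT) (i : ℕ) : Prop := i < D.length ∧ α ≤ (coveredByV D i).length

instance (α : ℕ) (D : DBWT) (i : ℕ) : Decidable (HeavyU α D i) :=
  inferInstanceAs (Decidable (_ ∧ _))

instance (α : ℕ) (D : DBWT) (i : ℕ) : Decidable (HeavyV α D i) :=
  inferInstanceAs (Decidable (_ ∧ _))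

def Balanced (α : ℕ) (D : DBWT) : Prop := ∀ i, ¬ HeavyU α D i ∧ ¬ HeavyV α D i

/-! ### Elementary operations on the sequence of nodes -/

/-- Splits the node that contains position `q` in its interior; does nothing if there is none. -/
def cutAt : DBWT → ℕ → DBWT
  | [], _ => []
  | (a, l) :: D, q =>
    if q = 0 then (a, l) :: D
    else if q < l then (a, q) :: (a, l - q) :: D
    else (a, l) :: cutAt D (q - l)

/-- Inserts the node `x` at position `q`, which is the start of a node or the end of the string. -/
def insertAt (x : ℕ × ℕ) : DBWT → ℕ → DBWT
  | [], _ => [x]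
  | (a, l) :: D, q => if q = 0 then x :: (a, l) :: D else (a, l) :: insertAt x D (q - l)

/-- Merges the node that ends right before position `q` with the node that starts at `q`. -/
def joinAt : DBWT → ℕ → DBWT
  | (a, l) :: (b, k) :: D, q =>
    if q = l then (a, l + k) :: D else (a, l) :: joinAt ((b, k) :: D) (q - l)
  | D, _ => D

/-- Character at the position before `q`, if there is one. -/
def charBefore (L : List ℕ) (q : ℕ) : Option ℕ := if q = 0 then none else L[q - 1]?

/-! ### Update of the LF-interval graph with the next character `c` -/

/-- Position of the special character in the string of `D`. -/
def repPos (D : DBWT) : ℕ := (expand D).idxOf dollar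

/-- Insertion position of the special character in the extended BWT. -/
def insPos (D : DBWT) (c : ℕ) : ℕ := occLt (expand D) c + rank (expand D) c (repPos D)

/-- Replace-node step: the node labelled `($, 1)` gets the label `(c, 1)`. -/
def replaceNode (D : DBWT) (c : ℕ) : DBWT := D.map fun x => if x = (dollar, 1) then (c, 1) else x

/-- Split-node step. -/
def splitNode (D : DBWT) (c : ℕ) : DBWT := cutAt (replaceNode D c) (insPos D c)

/-- Insert-node step. -/
def insertNode (D : DBWT) (c : ℕ) : DBWT := insertAt (dollar, 1) (splitNode D c) (insPos D c)

/-- Whether the split-node step splits a node, i.e. the insertion position lies strictly inside a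
repetition. -/
def splits (D : DBWT) (c : ℕ) : Bool :=
  (List.range D.length).any fun j =>
    decide (uStart D j < insPos D c ∧ insPos D c < uStart D j + len D j)

/-- Whether one of the two nodes next to the node of the special character is labelled with `c`; in
this case the fast update is applied. -/
def isFast (D : DBWT) (c : ℕ) : Bool :=
  charBefore (expand D) (repPos D) == some c || (expand D)[repPos D + 1]? == some c

/-- Position, after the insert-node step, of the node `(c, 1)` created by the replace-node step. -/
def newPos (D : DBWT) (c : ℕ) : ℕ := if insPos D c ≤ repPos D then repPos D + 1 else repPos D

/-- Merging of nodes in the fast update. The flag `prev` says whether the previous update split a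
node: the new node `(c, 1)` is merged with both of its neighbours labelled `c` only if it did. -/
def mergeNodes (D : DBWT) (c : ℕ) (prev : Bool) : DBWT :=
  let E := insertNode D c
  let q := newPos D c
  let left := charBefore (expand E) q == some c
  let right := (expand E)[q + 1]? == some c
  if left && right && prev then joinAt (joinAt E (q + 1)) q
  else if left then joinAt E q
  else if right then joinAt E (q + 1)
  else E

/-- The update of `D` with the next character `c`: the fast update if it applies, and otherwise
the update without merging. -/
def update (D : DBWT) (c : ℕ) (prev : Bool) : DBWT :=
  if isFast D c then mergeNodes D c prev else insertNode D c

/-! ### Balancing -/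

/-- The position at which the balancing operation splits an `α`-heavy repetition. -/
def cutU (D : DBWT) (i : ℕ) : ℕ :=
  (coveredByU D i).getD (((coveredByU D i).length + 1) / 2) 0

/-- The position at which the balancing operation splits the `i`-th repetition when its F-interval
is `α`-heavy: the offset in the F-interval is transferred to the repetition. -/
def cutV (D : DBWT) (i : ℕ) : ℕ :=
  uStart D i + ((coveredByV D i).getD (((coveredByV D i).length + 1) / 2) 0 - vStart D i)

/-- One iteration of the balancing operation, with an arbitrary choice of the heavy node. -/
inductive BalanceStep (α : ℕ) : DBWT → DBWT → Prop
  | caseU (D : DBWT) (i : ℕ) (h : HeavyU α D i) : BalanceStep α D (cutAt D (cutU D i))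
  | caseV (D : DBWT) (i : ℕ) (h' : ¬ HeavyU α D i) (h : HeavyV α D i) :
      BalanceStep α D (cutAt D (cutV D i))

/-! ### The r-comp algorithm -/

/-- The character read when `δ` characters, from the end of `T`, have been processed. -/
def nextChar (T : List ℕ) (δ : ℕ) : ℕ := T.getD (T.length - δ - 1) 0

/-- `Run α T δ D b`: after `δ` characters of `T` have been processed, r-comp can hold the
LF-interval graph of the balanced DBWT `D`; `b` says whether the last update split a node. -/
inductive Run (α : ℕ) (T : List ℕ) : ℕ → DBWT → Bool → Prop
  | init : Run α T 1 [(dollar, 1)] false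
  | step (δ : ℕ) (D D' : DBWT) (b : Bool) (h : Run α T δ D b) (hδ : δ < T.length)
      (hb : Relation.ReflTransGen (BalanceStep α) (update D (nextChar T δ) b) D')
      (hD' : Balanced α D') : Run α T (δ + 1) D' (splits D (nextChar T δ))

/-- The run-length encoding obtained from a DBWT by merging consecutive repetitions of the same
character. -/
def compress : DBWT → DBWT
  | (a, l) :: D =>
    match compress D with
    | (b, k) :: E => if a = b then (a, l + k) :: E else (a, l) :: (b, k) :: E
    | [] => [(a, l)]
  | [] => []

/-- `Visits α T D out`: at some time during a run of r-comp on `T` the LF-interval graph in memory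
is the one of `D`, while `out` is the content of the buffer used for the final conversion into
the RLBWT. -/
inductive Visits (α : ℕ) (T : List ℕ) : DBWT → DBWT → Prop
  | start (δ : ℕ) (D : DBWT) (b : Bool) (h : Run α T δ D b) : Visits α T D []
  | replaced (δ : ℕ) (D : DBWT) (b : Bool) (h : Run α T δ D b) (hδ : δ < T.length) :
      Visits α T (replaceNode D (nextChar T δ)) []
  | split (δ : ℕ) (D : DBWT) (b : Bool) (h : Run α T δ D b) (hδ : δ < T.length) :
      Visits α T (splitNode D (nextChar T δ)) []
  | inserted (δ : ℕ) (D : DBWT) (b : Bool) (h : Run α T δ D b) (hδ : δ < T.length) :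
      Visits α T (insertNode D (nextChar T δ)) []
  | balancing (δ : ℕ) (D D' : DBWT) (b : Bool) (h : Run α T δ D b) (hδ : δ < T.length)
      (hb : Relation.ReflTransGen (BalanceStep α) (update D (nextChar T δ) b) D') :
      Visits α T D' []
  | recovered (D : DBWT) (b : Bool) (h : Run α T T.length D b) : Visits α T D D
  | converted (D : DBWT) (b : Bool) (h : Run α T T.length D b) : Visits α T D (D ++ compress D)

/-! ### The LF-interval graph in memory

The nodes `u_i`, `v_i` of the graph of `D` are addressed by `i < k`, where `k = D.length`, and `k`
is the null pointer. Every field is one machine word. -/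

/-- Index of the F-interval that covers the start of the `i`-th repetition. -/
def edgeL (D : DBWT) (i : ℕ) : ℕ :=
  (List.range D.length).findIdx fun j =>
    decide (vStart D j ≤ uStart D i ∧ uStart D i < vStart D j + len D j)

/-- Index of the repetition that covers the start of the `j`-th F-interval. -/
def edgeF (D : DBWT) (j : ℕ) : ℕ :=
  (List.range D.length).findIdx fun i =>
    decide (uStart D i ≤ vStart D j ∧ vStart D j < uStart D i + len D i)

/-- The nodes of `V` in the order of the starting positions of their F-intervals. -/
def vOrder (D : DBWT) : List ℕ :=
  (List.range D.length).mergeSort fun i j => decide (vStart D i ≤ vStart D j)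

/-- The record of `u_i` in the doubly linked list of `U`: previous and next node, `E_LF`-pointer,
`E_L`-pointer and its label, character, length. -/
def uRecord (D : DBWT) (i : ℕ) : List ℕ :=
  [if i = 0 then D.length else i - 1, i + 1, i, edgeL D i, uStart D i - vStart D (edgeL D i),
    char D i, len D i]

/-- The record of `v_i` in the doubly linked list of `V`, with `E_F` in place of `E_L`. -/
def vRecord (D : DBWT) (i : ℕ) : List ℕ :=
  let p := (vOrder D).idxOf i
  [if p = 0 then D.length else (vOrder D).getD (p - 1) D.length, (vOrder D).getD (p + 1) D.length,
    i, edgeF D i, vStart D i - uStart D (edgeF D i), char D i, len D i]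

/-- The two doubly linked lists. -/
def graphWords (D : DBWT) : List ℕ :=
  (List.range D.length).flatMap (uRecord D) ++ (List.range D.length).flatMap (vRecord D)

/-- Order maintenance data structure: a list of groups, each with a tag and a list of elements
(pointer to a node of `U`, tag). -/
abbrev OrderList := List (ℕ × List (ℕ × ℕ))

/-- The structure holds the nodes `u_0, ..., u_{k-1}` in this order; tags are machine words of `w`
bits and increase along the groups and inside every group. -/
def OrderList.Valid (w k : ℕ) (o : OrderList) : Prop :=
  (o.flatMap fun g => g.2.map Prod.fst) = List.range k ∧
  (o.map Prod.fst).Pairwise (· < ·) ∧ (∀ g ∈ o, g.1 < 2 ^ w) ∧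
  ∀ g ∈ o, g.2 ≠ [] ∧ (g.2.map Prod.snd).Pairwise (· < ·) ∧ ∀ e ∈ g.2, e.2 < 2 ^ w

/-- A group stores its tag and two list pointers; an element stores its node, its tag, its group and
two list pointers. -/
def OrderList.words (k : ℕ) (o : OrderList) : List ℕ :=
  o.zipIdx.flatMap fun (g, j) =>
    [g.1, if j = 0 then o.length else j - 1, j + 1] ++
      g.2.flatMap fun e => [e.1, e.2, j, if e.1 = 0 then k else e.1 - 1, e.1 + 1]

/-- B-trees of height `h` whose keys are (indices of) nodes of `V`. -/
def BTree : ℕ → Type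
  | 0 => List ℕ
  | h + 1 => List ℕ × List (BTree h)

/-- The sequence `c₀, k₀, c₁, k₁, ...` of the keys of the children and the keys of a tree node. -/
def interleave : List (List ℕ) → List ℕ → List ℕ
  | [], ks => ks
  | c :: cs, [] => c ++ interleave cs []
  | c :: cs, k :: ks => c ++ k :: interleave cs ks

def BTree.inorder : (h : ℕ) → BTree h → List ℕ
  | 0, ks => ks
  | h + 1, (ks, cs) => interleave (cs.map (BTree.inorder h)) ks

/-- The shape conditions of a B-tree of order `m`: at most `m` children; at least `⌈m/2⌉` children
(resp. keys plus one) except at the root; an inner root has at least two children. -/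
def BTree.Valid (m : ℕ) : (root : Bool) → (h : ℕ) → BTree h → Prop
  | root, 0, ks =>
    List.length (α := ℕ) ks + 1 ≤ m ∧ (root = false → m ≤ 2 * (List.length (α := ℕ) ks + 1))
  | root, h + 1, (ks, cs) =>
    ks.length + 1 ≤ m ∧ (root = false → m ≤ 2 * (ks.length + 1)) ∧ 1 ≤ ks.length ∧
      cs.length = ks.length + 1 ∧ ∀ t ∈ cs, BTree.Valid m false h t

def BTree.numNodes : (h : ℕ) → BTree h → ℕ
  | 0, _ => 1
  | h + 1, (_, cs) => 1 + (cs.map (BTree.numNodes h)).sum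

/-- The addresses of consecutive subtrees that are stored from address `a` on. -/
def childAddrs (h : ℕ) : ℕ → List (BTree h) → List ℕ
  | _, [] => []
  | a, t :: ts => a :: childAddrs h (a + t.numNodes) ts

/-- The block of a tree node: number of keys, the keys (each with the pointer to `v_i`, the pointer
to `u_i` and the character of `u_i`), the addresses of the children; blocks have fixed size. -/
def btreeBlock (m : ℕ) (D : DBWT) (ks addrs : List ℕ) : List ℕ :=
  (ks.length :: (ks.flatMap fun i => [i, i, char D i]) ++ addrs).rightpad (4 * m) 0

def BTree.words (m : ℕ) (D : DBWT) : (h : ℕ) → ℕ → BTree h → List ℕ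
  | 0, _, ks => btreeBlock m D ks []
  | h + 1, a, (ks, cs) =>
    btreeBlock m D ks (childAddrs h (a + 1) cs) ++
      (cs.zip (childAddrs h (a + 1) cs)).flatMap fun (t, a') => BTree.words m D h a' t

/-- The parts of the memory that are not determined by the DBWT. -/
structure Memory where
  /-- array of the nodes of heavy repetitions -/
  heavyU : List ℕ
  /-- array of the nodes of heavy F-intervals -/
  heavyV : List ℕ
  order : OrderList
  height : ℕ
  btree : BTree height
  /-- local variables -/
  regs : List ℕ

/-- `M` is a possible content of the memory of r-comp while it holds the LF-interval graph of `D`: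
the heavy nodes are stored in any order, the B-tree of order `m` stores some of the nodes of `V`
in the order of `V`, and there are at most `ρ` local variables; words have `w` bits. -/
structure Memory.Represents (M : Memory) (w m ρ α : ℕ) (D : DBWT) : Prop where
  heavyU : M.heavyU.Perm ((List.range D.length).filter fun i => decide (HeavyU α D i))
  heavyV : M.heavyV.Perm ((List.range D.length).filter fun i => decide (HeavyV α D i))
  order : OrderList.Valid w D.length M.order
  btree : BTree.Valid m true M.height M.btree
  keys : (BTree.inorder M.height M.btree).Sublist (vOrder D)
  regs : M.regs.length ≤ ρ ∧ ∀ x ∈ M.regs, x < 2 ^ w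

/-- All machine words in use: the two linked lists, the two arrays (with their lengths), the order
maintenance structure, the B-tree, the local variables and the output buffer. -/
def Memory.words (M : Memory) (m : ℕ) (D out : DBWT) : List ℕ :=
  graphWords D ++ (M.heavyU.length :: M.heavyU) ++ (M.heavyV.length :: M.heavyV) ++
    OrderList.words D.length M.order ++ BTree.words m D M.height 0 M.btree ++ M.regs ++
    out.flatMap fun x => [x.1, x.2]

/-- Working space in bits, with machine words of `w` bits. -/
def Memory.bits (M : Memory) (w m : ℕ) (D out : DBWT) : ℕ := (M.words m D out).length * w

end RComp

/-! The bound on the number of repetitions is amortized. Let `$` stand at position `p` of the string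
of `D`, let `X` be the string without it, and let `S` be the set of boundaries of repetitions (the
end included) that survive in `X`, where a repetition that was cut only by the insertion of `$`
counts as uncut. Every `s ∈ S` appears on two axes with common coordinates: among the positions of
`D`, as the interval from `uLo p s` to `uHi p s` (a single point unless `s = p`), and as the start
`vRow X s` of an F-interval. On each axis, every gap between consecutive members is credited with
the number of members of the other axis strictly inside it, capped at `4`. The sum of all credits is
`totalPotential`; it is at most `2 * S.card`, since distinct gaps are disjoint. The invariant, part
of `Reduces`, is `3 * S.card ≤ totalPotential + 22 * runs X + 3`.

Balancing adds one boundary. It cuts a gap with many members of the other axis near its median, so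
both parts reach the cap and the credit on this axis grows by `4`. On the other axis the new
boundary is a single point that meets at most one member, so the credit there drops by at most `1`.
The net gain `3` pays for the boundary (`totalPotential_cutU`, `totalPotential_cutV`).

An update replaces `$` by `c` and inserts `$` at the row `ins`. Since the row of the new `c` on the
F-axis is also `ins`, both axes are stretched at the same place and no strict relation between them
is broken (`vRow_insert`, `totalPotential_le_image`). If a neighbour of the old `$` equals `c`, no
boundary is added. Otherwise two boundaries are added, which cost `3` each and up to `8` units of
credit each, but then `runs X` grows as well; this is the constant `22 = 2 * 3 + 2 * 8`
(`Reduces.update`). That merging depends only on the old neighbours of `$` uses that LF on a BWT has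
no fixed point at a character other than `$` (`lf_bwt_ne`).

Hence `S.card ≤ 22 * runs X + 3`. Reading the rest of the text only inserts characters into `X`, so
`runs X ≤ r` and `k ≤ 26 * r`. For the space, every structure occupies linearly many words in the
current number of repetitions, which is at most `28 * r` at any time, and every stored value is
polynomial in `n` or a tag or local variable that fits by assumption. -/

namespace RComp

/-! ### The potential of two families of intervals -/

/-- The members of the second family that lie strictly between the `s`-th interval of the first
family and all later ones. -/
def between (lo hi lo' hi' : ℕ → ℕ) (I J : Finset ℕ) (s : ℕ) : Finset ℕ :=
  J.filter fun t => hi s < lo' t ∧ ∀ s' ∈ I, hi s < lo s' → hi' t < lo s'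

/-- The cap makes the loss caused by an insertion bounded, while a cut into two well-filled parts
still gains the full `4`. -/
def potential (lo hi lo' hi' : ℕ → ℕ) (I J : Finset ℕ) : ℕ :=
  ∑ s ∈ I, min 4 (between lo hi lo' hi' I J s).card

/-- The intervals of the family are non-empty, disjoint and hence linearly ordered. -/
def Separated (lo hi : ℕ → ℕ) (I : Finset ℕ) : Prop :=
  (∀ s ∈ I, lo s ≤ hi s) ∧ ∀ s ∈ I, ∀ s' ∈ I, s ≠ s' → hi s < lo s' ∨ hi s' < lo s

/-- Gaps after distinct members of the first family are disjoint, so each member of the second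
family is counted at most once. -/
theorem potential_le_card {lo hi lo' hi' : ℕ → ℕ} {I J : Finset ℕ} (hI : Separated lo hi I)
    (hJ : ∀ t ∈ J, lo' t ≤ hi' t) : potential lo hi lo' hi' I J ≤ J.card := by
  have h1 : potential lo hi lo' hi' I J ≤ ∑ s ∈ I, (between lo hi lo' hi' I J s).card :=
    Finset.sum_le_sum fun s _ => min_le_right _ _
  refine h1.trans ?_
  rw [← Finset.card_biUnion]
  · exact Finset.card_le_card (Finset.biUnion_subset.2 fun s _ => Finset.filter_subset _ _)
  · intro s hs s' hs' hne
    rw [Function.onFun, Finset.disjoint_left]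
    intro t ht ht'
    simp only [between, Finset.mem_filter] at ht ht'
    have h0 := hJ t ht.1
    rcases hI.2 s hs s' hs' hne with h | h
    · have := ht.2.2 s' hs' h
      have := hI.1 s' hs'
      omega
    · have := ht'.2.2 s hs h
      have := hI.1 s hs
      omega

theorem potential_mono_right {lo hi lo' hi' : ℕ → ℕ} {I J J' : Finset ℕ} (h : J ⊆ J') :
    potential lo hi lo' hi' I J ≤ potential lo hi lo' hi' I J' :=
  Finset.sum_le_sum fun _ _ => min_le_min_left _
    (Finset.card_le_card (Finset.filter_subset_filter _ h))

/-- Moving the intervals without breaking a strict relation between the two families does not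
decrease the potential. -/
theorem potential_le_image {lo hi lo' hi' lo₁ hi₁ lo₁' hi₁' f : ℕ → ℕ} {I : Finset ℕ}
    (hf : Set.InjOn f I)
    (hx : ∀ s ∈ I, ∀ s' ∈ I, hi₁ (f s) < lo₁ (f s') → hi s < lo s')
    (h1 : ∀ s ∈ I, ∀ t ∈ I, hi s < lo' t → hi₁ (f s) < lo₁' (f t))
    (h2 : ∀ s ∈ I, ∀ t ∈ I, hi' t < lo s → hi₁' (f t) < lo₁ (f s)) :
    potential lo hi lo' hi' I I ≤ potential lo₁ hi₁ lo₁' hi₁' (I.image f) (I.image f) := by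
  unfold potential
  rw [Finset.sum_image hf]
  refine Finset.sum_le_sum fun s hs => min_le_min_left _ ?_
  refine Finset.card_le_card_of_injOn f ?_ (hf.mono ?_)
  · intro t ht
    simp only [between, Finset.coe_filter, Set.mem_ofPred_eq, Finset.mem_image] at ht ⊢
    refine ⟨⟨t, ht.1, rfl⟩, h1 s hs t ht.1 ht.2.1, ?_⟩
    rintro _ ⟨s', hs', rfl⟩ hss
    exact h2 s' hs' t ht.1 (ht.2.2 s' hs' (hx s hs s' hs' hss))
  · exact fun t ht => Finset.filter_subset _ _ ht

/-- Only the gap that receives `e` changes: it belongs to the predecessor `s` of `e` and is cut into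
the part before `e` and the part after `e`, which becomes the gap of `e`. The first alternative is
the case without a predecessor. The equation keeps the two capped parts and the old capped gap
separate, so that upper and lower bounds both follow from it. -/
theorem potential_insert {lo hi lo' hi' : ℕ → ℕ} {I J : Finset ℕ} {e : ℕ} (he : e ∉ I)
    (hI : Separated lo hi (insert e I)) :
    potential lo hi lo' hi' I J + min 4 (between lo hi lo' hi' I J e).card =
        potential lo hi lo' hi' (insert e I) J ∨
      ∃ s ∈ I, hi s < lo e ∧ (∀ s' ∈ I, hi s' < lo e → hi s' ≤ hi s) ∧
        potential lo hi lo' hi' I J + min 4 (between lo hi lo' hi' I J e).card +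
          min 4 (J.filter fun t => hi s < lo' t ∧ hi' t < lo e).card =
        potential lo hi lo' hi' (insert e I) J + min 4 (between lo hi lo' hi' I J s).card := by
  have heI : ∀ s ∈ I, hi s < lo e ∨ hi e < lo s := fun s hs =>
    hI.2 s (Finset.mem_insert_of_mem hs) e (Finset.mem_insert_self _ _) (by rintro rfl; exact he hs)
  have hle : ∀ s ∈ I, lo s ≤ hi s := fun s hs => hI.1 s (Finset.mem_insert_of_mem hs)
  have hee := hI.1 e (Finset.mem_insert_self _ _)
  have hnew : between lo hi lo' hi' (insert e I) J e = between lo hi lo' hi' I J e := by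
    refine Finset.filter_congr fun t _ => ?_
    simp only [Finset.mem_insert, forall_eq_or_imp]
    have : ¬ hi e < lo e := by omega
    simp [this]
  have hafter : ∀ s ∈ I, hi e < lo s →
      between lo hi lo' hi' (insert e I) J s = between lo hi lo' hi' I J s := by
    intro s hs h
    refine Finset.filter_congr fun t _ => ?_
    simp only [Finset.mem_insert, forall_eq_or_imp]
    have h3 := hle s hs
    have : ¬ hi s < lo e := by omega
    simp [this]
  by_cases hne : (I.filter fun s => hi s < lo e).Nonempty
  · right
    obtain ⟨s, hs, hmax⟩ := Finset.exists_max_image _ hi hne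
    simp only [Finset.mem_filter, and_imp] at hs hmax
    obtain ⟨hsI, hse⟩ := hs
    refine ⟨s, hsI, hse, hmax, ?_⟩
    have hother : ∀ s' ∈ I.erase s,
        between lo hi lo' hi' (insert e I) J s' = between lo hi lo' hi' I J s' := by
      intro s' hs'
      obtain ⟨hne', hs'I⟩ := Finset.mem_erase.1 hs'
      rcases heI s' hs'I with h | h
      · refine Finset.filter_congr fun t ht => ?_
        simp only [Finset.mem_insert, forall_eq_or_imp]
        have h4 : hi s' < lo s := by
          rcases hI.2 s' (Finset.mem_insert_of_mem hs'I) s (Finset.mem_insert_of_mem hsI) hne'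
            with h5 | h5
          · exact h5
          · have := hmax s' hs'I h
            have := hle s' hs'I
            omega
        constructor
        · rintro ⟨a, -, b⟩; exact ⟨a, b⟩
        · rintro ⟨a, b⟩
          refine ⟨a, fun _ => ?_, b⟩
          have := b s hsI h4
          have := hle s hsI
          omega
      · exact hafter s' hs'I h
    have hself : between lo hi lo' hi' (insert e I) J s =
        J.filter fun t => hi s < lo' t ∧ hi' t < lo e := by
      refine Finset.filter_congr fun t ht => ?_
      simp only [Finset.mem_insert, forall_eq_or_imp]
      constructor
      · rintro ⟨a, b, -⟩; exact ⟨a, b hse⟩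
      · rintro ⟨a, b⟩
        refine ⟨a, fun _ => b, fun s' hs' hss' => ?_⟩
        rcases heI s' hs' with h | h
        · have := hmax s' hs' h
          have := hle s' hs'
          omega
        · omega
    unfold potential
    rw [Finset.sum_insert he, hnew, ← Finset.add_sum_erase _ _ hsI,
      ← Finset.add_sum_erase I (fun s => min 4 (between lo hi lo' hi' (insert e I) J s).card) hsI,
      hself]
    have hsum : ∑ s' ∈ I.erase s, min 4 (between lo hi lo' hi' (insert e I) J s').card =
        ∑ s' ∈ I.erase s, min 4 (between lo hi lo' hi' I J s').card :=
      Finset.sum_congr rfl fun s' hs' => by rw [hother s' hs']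
    omega
  · left
    unfold potential
    rw [Finset.sum_insert he, hnew, add_comm]
    congr 1
    refine Finset.sum_congr rfl fun s hs => ?_
    rw [hafter s hs]
    rcases heI s hs with h | h
    · exact absurd ⟨s, Finset.mem_filter.2 ⟨hs, h⟩⟩ hne
    · exact h

/-- Every term but that of the predecessor is kept, and that term is capped at `4`. -/
theorem potential_le_insert_add {lo hi lo' hi' : ℕ → ℕ} {I J : Finset ℕ} {e : ℕ}
    (hI : Separated lo hi (insert e I)) :
    potential lo hi lo' hi' I J ≤ potential lo hi lo' hi' (insert e I) J + 4 := by
  by_cases he : e ∈ I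
  · rw [Finset.insert_eq_of_mem he]; omega
  rcases potential_insert (lo' := lo') (hi' := hi') (J := J) he hI with h | ⟨s, -, -, -, h⟩ <;>
    omega

/-- Inserting an interval that meets at most one member of the second family. -/
theorem potential_le_insert_add_one {lo hi lo' hi' : ℕ → ℕ} {I J : Finset ℕ} {e : ℕ} (he : e ∉ I)
    (hI : Separated lo hi (insert e I))
    (h1 : ∀ t ∈ J, ∀ t' ∈ J, lo' t ≤ hi e → lo e ≤ hi' t → lo' t' ≤ hi e → lo e ≤ hi' t' → t = t') :
    potential lo hi lo' hi' I J ≤ potential lo hi lo' hi' (insert e I) J + 1 := by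
  rcases potential_insert (lo' := lo') (hi' := hi') (J := J) he hI with h | ⟨s, hs, hse, hmax, h⟩
  · omega
  have hee := hI.1 e (Finset.mem_insert_self _ _)
  -- A member of the old gap lies before `e`, after `e`, or meets `e`. The last kind occurs at most
  -- once, and `min 4` is subadditive.
  have hsub : between lo hi lo' hi' I J s ⊆
      (J.filter fun t => hi s < lo' t ∧ hi' t < lo e) ∪ between lo hi lo' hi' I J e ∪
        J.filter fun t => lo' t ≤ hi e ∧ lo e ≤ hi' t := by
    intro t ht
    simp only [between, Finset.mem_filter, Finset.mem_union] at ht ⊢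
    by_cases ha : hi' t < lo e
    · exact Or.inl (Or.inl ⟨ht.1, ht.2.1, ha⟩)
    by_cases hb : hi e < lo' t
    · exact Or.inl (Or.inr ⟨ht.1, hb, fun s' hs' hs'' => ht.2.2 s' hs' (by omega)⟩)
    · exact Or.inr ⟨ht.1, by omega, by omega⟩
  have hone : (J.filter fun t => lo' t ≤ hi e ∧ lo e ≤ hi' t).card ≤ 1 := by
    rw [Finset.card_le_one]
    intro a ha b hb
    simp only [Finset.mem_filter] at ha hb
    exact h1 a ha.1 b hb.1 ha.2.1 ha.2.2 hb.2.1 hb.2.2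
  have h2 := (Finset.card_le_card hsub).trans
    ((Finset.card_union_le _ _).trans (Nat.add_le_add_right (Finset.card_union_le _ _) _))
  omega

/-- Splitting an interval between consecutive members of the first family into two parts that
contain many members of the second family. -/
theorem potential_add_four_le_insert {lo hi lo' hi' : ℕ → ℕ} {I J A B : Finset ℕ} {e : ℕ}
    (he : e ∉ I) (hI : Separated lo hi (insert e I))
    (hA : A ⊆ J) (hB : B ⊆ J) (hA4 : 4 ≤ A.card) (hB4 : 4 ≤ B.card)
    (hA' : ∀ t ∈ A, hi' t < lo e ∧ ∀ s ∈ I, hi s < lo e → hi s < lo' t)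
    (hB' : ∀ t ∈ B, hi e < lo' t ∧ ∀ s ∈ I, hi e < lo s → hi' t < lo s) :
    potential lo hi lo' hi' I J + 4 ≤ potential lo hi lo' hi' (insert e I) J := by
  have hBc : 4 ≤ (between lo hi lo' hi' I J e).card :=
    hB4.trans (Finset.card_le_card fun t ht =>
      Finset.mem_filter.2 ⟨hB ht, (hB' t ht).1, (hB' t ht).2⟩)
  rcases potential_insert (lo' := lo') (hi' := hi') (J := J) he hI with h | ⟨s, hs, hse, hmax, h⟩
  · omega
  have hAc : 4 ≤ (J.filter fun t => hi s < lo' t ∧ hi' t < lo e).card :=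
    hA4.trans (Finset.card_le_card fun t ht =>
      Finset.mem_filter.2 ⟨hA ht, (hA' t ht).2 s hs hse, (hA' t ht).1⟩)
  omega

/-! ### Boundaries of the repetitions -/

def size (D : DBWT) : ℕ := (D.map Prod.snd).sum

def Pos (D : DBWT) : Prop := ∀ x ∈ D, 0 < x.2

/-- The starting positions of the repetitions together with the end of the string. -/
def bnd : DBWT → Finset ℕ
  | [] => {0}
  | x :: D => insert 0 ((bnd D).image (x.2 + ·))

@[simp] theorem size_nil : size [] = 0 := rfl

@[simp] theorem size_cons (x : ℕ × ℕ) (D : DBWT) : size (x :: D) = x.2 + size D := by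
  simp [size]

@[simp] theorem expand_nil : expand [] = [] := rfl

@[simp] theorem expand_cons (x : ℕ × ℕ) (D : DBWT) :
    expand (x :: D) = List.replicate x.2 x.1 ++ expand D := by
  simp [expand]

theorem length_expand (D : DBWT) : (expand D).length = size D := by
  induction D with
  | nil => rfl
  | cons x D ih => simp [ih]

theorem pos_cons {x : ℕ × ℕ} {D : DBWT} : Pos (x :: D) ↔ 0 < x.2 ∧ Pos D := by
  simp [Pos]

theorem mem_bnd_cons {x : ℕ × ℕ} {D : DBWT} {q : ℕ} :
    q ∈ bnd (x :: D) ↔ q = 0 ∨ x.2 ≤ q ∧ q - x.2 ∈ bnd D := by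
  simp only [bnd, Finset.mem_insert, Finset.mem_image]
  constructor
  · rintro (h | ⟨r, hr, rfl⟩)
    · exact Or.inl h
    · exact Or.inr ⟨by omega, by simpa using hr⟩
  · rintro (h | ⟨h, h'⟩)
    · exact Or.inl h
    · exact Or.inr ⟨_, h', by omega⟩

theorem zero_mem_bnd (D : DBWT) : 0 ∈ bnd D := by
  cases D <;> simp [bnd]

theorem size_mem_bnd (D : DBWT) : size D ∈ bnd D := by
  induction D with
  | nil => simp [bnd]
  | cons x D ih => rw [mem_bnd_cons]; simp [ih]

theorem le_size_of_mem_bnd {D : DBWT} {q : ℕ} (h : q ∈ bnd D) : q ≤ size D := by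
  induction D generalizing q with
  | nil => simp_all [bnd]
  | cons x D ih =>
    rw [mem_bnd_cons] at h
    rcases h with h | ⟨h, h'⟩
    · omega
    · have := ih h'
      simp; omega

/-- Positive lengths keep the boundaries distinct; the extra one is the end of the string. -/
theorem card_bnd {D : DBWT} (h : Pos D) : (bnd D).card = D.length + 1 := by
  induction D with
  | nil => simp [bnd]
  | cons x D ih =>
    rw [pos_cons] at h
    rw [bnd, Finset.card_insert_of_notMem, Finset.card_image_of_injective, ih h.2, List.length_cons]
    · exact fun a b hab => by simpa using hab
    · simp; omega

theorem length_le_size {D : DBWT} (h : Pos D) : D.length ≤ size D := by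
  induction D with
  | nil => simp
  | cons x D ih =>
    rw [pos_cons] at h
    have := ih h.2
    simp; omega

theorem uStart_cons_succ (x : ℕ × ℕ) (D : DBWT) (i : ℕ) :
    uStart (x :: D) (i + 1) = x.2 + uStart D i := by
  simp [uStart]

@[simp] theorem uStart_zero (D : DBWT) : uStart D 0 = 0 := rfl

theorem uStart_mem_bnd (D : DBWT) (i : ℕ) : uStart D i ∈ bnd D := by
  induction D generalizing i with
  | nil => simp [uStart, bnd]
  | cons x D ih =>
    cases i with
    | zero => simp [mem_bnd_cons]
    | succ i => rw [uStart_cons_succ, mem_bnd_cons]; simp [ih]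

theorem uStart_succ (D : DBWT) {i : ℕ} (hi : i < D.length) :
    uStart D (i + 1) = uStart D i + len D i := by
  rw [uStart, List.take_add_one, List.map_append, List.sum_append, ← uStart]
  simp [len, hi]

theorem uStart_le_size (D : DBWT) (i : ℕ) : uStart D i ≤ size D :=
  le_size_of_mem_bnd (uStart_mem_bnd D i)

theorem len_pos {D : DBWT} (h : Pos D) {i : ℕ} (hi : i < D.length) : 0 < len D i := by
  have := h (D[i]) (List.getElem_mem hi)
  simpa [len, hi] using this

theorem uStart_lt_size {D : DBWT} (h : Pos D) {i : ℕ} (hi : i < D.length) :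
    uStart D i < size D := by
  have h1 := uStart_le_size D (i + 1)
  have h2 := len_pos h hi
  rw [uStart_succ D hi] at h1
  omega

theorem uStart_inj {D : DBWT} (h : Pos D) {i j : ℕ} (hi : i < D.length) (hj : j < D.length)
    (he : uStart D i = uStart D j) : i = j := by
  induction D generalizing i j with
  | nil => simp at hi
  | cons x D ih =>
    rw [pos_cons] at h
    cases i <;> cases j
    · rfl
    · rw [uStart_cons_succ] at he; simp at he; omega
    · rw [uStart_cons_succ] at he; simp at he; omega
    · rw [uStart_cons_succ, uStart_cons_succ] at he
      simp only [List.length_cons] at hi hj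
      have := ih h.2 (i := _) (j := _) (Nat.lt_of_succ_lt_succ hi) (Nat.lt_of_succ_lt_succ hj)
        (Nat.add_left_cancel he)
      rw [this]

/-- There is no boundary in the interior of a repetition. -/
theorem le_or_le_of_mem_bnd {D : DBWT} {i : ℕ} (hi : i < D.length) {q : ℕ}
    (hq : q ∈ bnd D) : q ≤ uStart D i ∨ uStart D i + len D i ≤ q := by
  induction D generalizing i q with
  | nil => simp at hi
  | cons x D ih =>
    rw [mem_bnd_cons] at hq
    rcases hq with hq | ⟨hq, hq'⟩
    · omega
    cases i with
    | zero => right; simpa [len] using hq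
    | succ i =>
      simp only [List.length_cons] at hi
      have := ih (Nat.lt_of_succ_lt_succ hi) hq'
      rw [uStart_cons_succ]
      have h : len (x :: D) (i + 1) = len D i := by simp [len]
      omega

theorem getElem?_expand_of_mem {D : DBWT} {i : ℕ} (hi : i < D.length) {j : ℕ}
    (h1 : uStart D i ≤ j) (h2 : j < uStart D i + len D i) : (expand D)[j]? = some (char D i) := by
  induction D generalizing i j with
  | nil => simp at hi
  | cons x D ih =>
    cases i with
    | zero =>
      have h2 : j < x.2 := by simpa [len] using h2
      rw [expand_cons, List.getElem?_append_left (by simpa using h2)]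
      simp [char, h2]
    | succ i =>
      rw [uStart_cons_succ] at h1 h2
      have h : len (x :: D) (i + 1) = len D i := by simp [len]
      have h' : char (x :: D) (i + 1) = char D i := by simp [char]
      simp only [List.length_cons] at hi
      rw [expand_cons, List.getElem?_append_right (by simp; omega), h']
      exact ih (by omega) (by simp; omega) (by simp; omega)

/-- Every position lies in a repetition. -/
theorem exists_uStart_le_lt {D : DBWT} {q : ℕ} (hq : q < size D) :
    ∃ i < D.length, uStart D i ≤ q ∧ q < uStart D i + len D i := by
  induction D generalizing q with
  | nil => simp at hq
  | cons x D ih =>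
    by_cases h : q < x.2
    · exact ⟨0, by simp, by simp, by simpa [len] using h⟩
    · simp only [size_cons] at hq
      obtain ⟨i, hi, h1, h2⟩ := ih (q := q - x.2) (by omega)
      have h' : len (x :: D) (i + 1) = len D i := by simp [len]
      exact ⟨i + 1, by simpa using hi, by rw [uStart_cons_succ]; omega,
        by rw [uStart_cons_succ]; omega⟩

/-- The bound on `insPos` matters: a position beyond the end is in no repetition, but is no boundary
either. -/
theorem splits_iff {D : DBWT} {c : ℕ} (h : insPos D c ≤ size D) :
    splits D c = true ↔ insPos D c ∉ bnd D := by
  simp only [splits, List.any_eq_true, List.mem_range, decide_eq_true_eq]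
  constructor
  · rintro ⟨j, hj, h1, h2⟩ hm
    have := le_or_le_of_mem_bnd hj hm
    omega
  · intro hm
    have h1 : insPos D c ≠ size D := fun he => hm (he ▸ size_mem_bnd D)
    obtain ⟨i, hi, h2, h3⟩ := exists_uStart_le_lt (D := D) (q := insPos D c) (by omega)
    refine ⟨i, hi, lt_of_le_of_ne h2 ?_, h3⟩
    intro he
    exact hm (he ▸ uStart_mem_bnd D i)

/-- Two neighbouring characters of the same repetition are equal. -/
theorem getElem?_expand_pred_eq {D : DBWT} {q : ℕ} (hq : q < size D) (hm : q ∉ bnd D) :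
    0 < q ∧ (expand D)[q - 1]? = (expand D)[q]? := by
  obtain ⟨i, hi, h2, h3⟩ := exists_uStart_le_lt hq
  have h4 : uStart D i ≠ q := fun he => hm (he ▸ uStart_mem_bnd D i)
  refine ⟨by omega, ?_⟩
  rw [getElem?_expand_of_mem hi h2 h3, getElem?_expand_of_mem hi (by omega) (by omega)]

/-! ### Effect of the elementary operations -/

theorem expand_cutAt (D : DBWT) (q : ℕ) : expand (cutAt D q) = expand D := by
  induction D generalizing q with
  | nil => rfl
  | cons x D ih =>
    obtain ⟨a, l⟩ := x
    rw [cutAt]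
    split_ifs with h1 h2
    · rfl
    · simp only [expand_cons, ← List.append_assoc, ← List.replicate_add]
      congr 3; omega
    · simp [ih]

theorem pos_cutAt {D : DBWT} (h : Pos D) (q : ℕ) : Pos (cutAt D q) := by
  induction D generalizing q with
  | nil => exact h
  | cons x D ih =>
    obtain ⟨a, l⟩ := x
    rw [cutAt]
    split_ifs with h1 h2
    · exact h
    · simp only [pos_cons] at h ⊢; exact ⟨by omega, by omega, h.2⟩
    · simp only [pos_cons] at h ⊢; exact ⟨h.1, ih h.2 _⟩

theorem bnd_cutAt {D : DBWT} {q : ℕ} (hq : q ≤ size D) : bnd (cutAt D q) = insert q (bnd D) := by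
  induction D generalizing q with
  | nil => simp at hq; simp [cutAt, bnd, hq]
  | cons x D ih =>
    obtain ⟨a, l⟩ := x
    rw [cutAt]
    split_ifs with h1 h2
    · rw [Finset.insert_eq_of_mem]; rw [h1]; exact zero_mem_bnd _
    · ext r
      simp only [Finset.mem_insert, mem_bnd_cons]
      have := zero_mem_bnd D
      constructor
      · rintro (h | ⟨h, h' | ⟨h', h''⟩⟩)
        · omega
        · left; omega
        · right; right; exact ⟨by omega, by rwa [show r - l = r - q - (l - q) by omega]⟩
      · rintro (h | h | ⟨h, h'⟩)
        · right; exact ⟨by omega, by omega⟩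
        · left; omega
        · right; exact ⟨by omega, Or.inr ⟨by omega, by rwa [show r - q - (l - q) = r - l by omega]⟩⟩
    · simp only [size_cons] at hq
      ext r
      simp only [Finset.mem_insert, mem_bnd_cons, ih (q := q - l) (by omega)]
      constructor
      · rintro (h | ⟨h, h' | h'⟩)
        · exact Or.inr (Or.inl h)
        · left; omega
        · exact Or.inr (Or.inr ⟨h, h'⟩)
      · rintro (h | h | ⟨h, h'⟩)
        · right; exact ⟨by omega, by omega⟩
        · left; omega
        · exact Or.inr ⟨h, Or.inr h'⟩

theorem length_cutAt_le (D : DBWT) (q : ℕ) : (cutAt D q).length ≤ D.length + 1 := by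
  induction D generalizing q with
  | nil => simp [cutAt]
  | cons x D ih =>
    obtain ⟨a, l⟩ := x
    rw [cutAt]
    split_ifs with h1 h2
    · simp
    · simp
    · simpa using ih _

theorem length_insertAt (x : ℕ × ℕ) (D : DBWT) (q : ℕ) :
    (insertAt x D q).length = D.length + 1 := by
  induction D generalizing q with
  | nil => simp [insertAt]
  | cons y D ih =>
    obtain ⟨a, l⟩ := y
    rw [insertAt]
    split_ifs with h1
    · simp
    · simp [ih]

theorem pos_insertAt {x : ℕ × ℕ} {D : DBWT} (hx : 0 < x.2) (h : Pos D) (q : ℕ) :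
    Pos (insertAt x D q) := by
  induction D generalizing q with
  | nil => simp [insertAt, Pos, hx]
  | cons y D ih =>
    obtain ⟨a, l⟩ := y
    rw [insertAt]
    split_ifs with h1
    · simp only [pos_cons] at h ⊢; exact ⟨hx, h⟩
    · simp only [pos_cons] at h ⊢; exact ⟨h.1, ih h.2 _⟩

theorem expand_insertAt {x : ℕ × ℕ} {D : DBWT} (h : Pos D) {q : ℕ} (hq : q ∈ bnd D) :
    expand (insertAt x D q) =
      (expand D).take q ++ (List.replicate x.2 x.1 ++ (expand D).drop q) := by
  induction D generalizing q with
  | nil => simp [insertAt]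
  | cons y D ih =>
    obtain ⟨a, l⟩ := y
    rw [insertAt]
    rw [pos_cons] at h
    rw [mem_bnd_cons] at hq
    split_ifs with h1
    · simp [h1]
    · obtain ⟨h2, h3⟩ := hq.resolve_left h1
      simp only [expand_cons, ih h.2 h3]
      simp only at h2
      rw [List.take_append, List.drop_append]
      simp [min_eq_right h2, Nat.sub_eq_zero_of_le h2]

theorem bnd_insertAt {x : ℕ × ℕ} {D : DBWT} (h : Pos D) {q : ℕ} (hq : q ∈ bnd D) (r : ℕ) :
    r ∈ bnd (insertAt x D q) ↔ (r ≤ q ∧ r ∈ bnd D) ∨ (q + x.2 ≤ r ∧ r - x.2 ∈ bnd D) := by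
  induction D generalizing q r with
  | nil =>
    simp only [bnd, Finset.mem_singleton] at hq
    subst hq
    simp only [insertAt, mem_bnd_cons]
    simp [bnd]
  | cons y D ih =>
    obtain ⟨a, l⟩ := y
    rw [insertAt]
    rw [pos_cons] at h
    have hq' := hq
    rw [mem_bnd_cons] at hq
    split_ifs with h1
    · subst h1
      rw [mem_bnd_cons]
      constructor
      · rintro (h | h)
        · left; exact ⟨h.le, h ▸ zero_mem_bnd _⟩
        · right; simpa using h
      · rintro (h | h)
        · left; omega
        · right; simpa using h
    · obtain ⟨h2, h3⟩ := hq.resolve_left h1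
      simp only [mem_bnd_cons, ih h.2 h3]
      have hl := h.1
      simp only at h2 h3 hl
      constructor
      · rintro (h | ⟨h, ⟨h4, h5⟩ | ⟨h4, h5⟩⟩)
        · left; omega
        · left; exact ⟨by omega, Or.inr ⟨h, h5⟩⟩
        · right; exact ⟨by omega, Or.inr ⟨by omega, by rwa [Nat.sub_right_comm]⟩⟩
      · rintro (⟨h, h4 | ⟨h4, h5⟩⟩ | ⟨h, h4 | ⟨h4, h5⟩⟩)
        · left; exact h4
        · right; exact ⟨h4, Or.inl ⟨by omega, h5⟩⟩
        · omega
        · right; exact ⟨by omega, Or.inr ⟨by omega, by rwa [Nat.sub_right_comm]⟩⟩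

theorem pos_joinAt {D : DBWT} (h : Pos D) (q : ℕ) : Pos (joinAt D q) := by
  induction D generalizing q with
  | nil => simpa [joinAt] using h
  | cons y D ih =>
    cases D with
    | nil => simpa [joinAt] using h
    | cons z D =>
      obtain ⟨a, l⟩ := y
      obtain ⟨b, k⟩ := z
      rw [joinAt]
      split_ifs with h1
      · simp only [pos_cons] at h ⊢; exact ⟨by omega, h.2.2⟩
      · rw [pos_cons] at h ⊢; exact ⟨h.1, ih h.2 _⟩

theorem expand_joinAt {D : DBWT} (h : Pos D) {q : ℕ} (hq : q ∈ bnd D) (h0 : 0 < q)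
    (hs : (expand D)[q - 1]? = (expand D)[q]?) : expand (joinAt D q) = expand D := by
  induction D generalizing q with
  | nil => rfl
  | cons y D ih =>
    cases D with
    | nil => rfl
    | cons z D =>
      obtain ⟨a, l⟩ := y
      obtain ⟨b, k⟩ := z
      rw [joinAt]
      have h' := h
      simp only [pos_cons] at h'
      split_ifs with h1
      · subst h1
        have hab : a = b := by
          rw [expand_cons, List.getElem?_append_left (by simp; omega),
            List.getElem?_append_right (by simp)] at hs
          simp [h'.1, h'.2.1] at hs
          exact hs
        subst hab
        simp only [expand_cons, List.replicate_add, List.append_assoc]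
      · rw [mem_bnd_cons] at hq
        obtain ⟨h2, h3⟩ := hq.resolve_left (by omega)
        simp only at h2 h3
        rw [expand_cons, ih (pos_cons.1 h).2 h3 (by omega), expand_cons (a, l)]
        rw [expand_cons, List.getElem?_append_right (by simp; omega),
          List.getElem?_append_right (by simp; omega)] at hs
        simp only [List.length_replicate] at hs
        rwa [Nat.sub_right_comm]

theorem bnd_joinAt {D : DBWT} (h : Pos D) {q : ℕ} (hq : q ∈ bnd D) (h0 : 0 < q)
    (hs : q < size D) : bnd (joinAt D q) = (bnd D).erase q := by
  induction D generalizing q with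
  | nil => simp at hs
  | cons y D ih =>
    cases D with
    | nil => rw [mem_bnd_cons] at hq; simp at hs; omega
    | cons z D =>
      obtain ⟨a, l⟩ := y
      obtain ⟨b, k⟩ := z
      rw [joinAt]
      have h' := h
      simp only [pos_cons] at h'
      split_ifs with h1
      · subst h1
        ext r
        simp only [Finset.mem_erase, mem_bnd_cons]
        rw [Nat.sub_sub]
        constructor
        · rintro (h3 | ⟨h3, h4⟩)
          · exact ⟨by omega, Or.inl h3⟩
          · exact ⟨by omega, Or.inr ⟨by omega, Or.inr ⟨by omega, h4⟩⟩⟩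
        · rintro ⟨h2, h3 | ⟨h3, h4 | ⟨h4, h5⟩⟩⟩
          · exact Or.inl h3
          · omega
          · exact Or.inr ⟨by omega, h5⟩
      · rw [mem_bnd_cons] at hq
        obtain ⟨h2, h3⟩ := hq.resolve_left (by omega)
        simp only at h2 h3
        rw [size_cons] at hs
        simp only at hs
        ext r
        rw [mem_bnd_cons, ih (pos_cons.1 h).2 h3 (by omega) (by omega), Finset.mem_erase,
          Finset.mem_erase, mem_bnd_cons (x := (a, l))]
        simp only
        constructor
        · rintro (h3 | ⟨h3, h4, h5⟩)
          · exact ⟨by omega, Or.inl h3⟩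
          · exact ⟨by omega, Or.inr ⟨h3, h5⟩⟩
        · rintro ⟨h2, h3 | ⟨h3, h5⟩⟩
          · exact Or.inl h3
          · exact Or.inr ⟨h3, by omega, h5⟩

@[simp] theorem length_replaceNode (D : DBWT) (c : ℕ) : (replaceNode D c).length = D.length := by
  simp [replaceNode]

theorem pos_replaceNode {D : DBWT} (h : Pos D) (c : ℕ) : Pos (replaceNode D c) := by
  intro x hx
  simp only [replaceNode, List.mem_map] at hx
  obtain ⟨y, hy, rfl⟩ := hx
  split_ifs
  · simp
  · exact h y hy

theorem bnd_replaceNode (D : DBWT) (c : ℕ) : bnd (replaceNode D c) = bnd D := by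
  induction D with
  | nil => rfl
  | cons x D ih =>
    rw [replaceNode, List.map_cons, ← replaceNode, bnd, bnd, ih]
    split_ifs with h
    · subst h; rfl
    · rfl

theorem size_replaceNode (D : DBWT) (c : ℕ) : size (replaceNode D c) = size D := by
  induction D with
  | nil => rfl
  | cons x D ih =>
    rw [replaceNode, List.map_cons, ← replaceNode, size_cons, size_cons, ih]
    split_ifs with h
    · subst h; rfl
    · rfl

theorem expand_replaceNode {D : DBWT} (c : ℕ) (h : Pos D)
    (h1 : (expand D).count dollar ≤ 1) :
    expand (replaceNode D c) = (expand D).map fun x => if x = dollar then c else x := by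
  induction D with
  | nil => rfl
  | cons x D ih =>
    rw [pos_cons] at h
    rw [expand_cons, List.count_append, List.count_replicate] at h1
    rw [replaceNode, List.map_cons, ← replaceNode, expand_cons, expand_cons, List.map_append,
      List.map_replicate, ih h.2 (by omega)]
    congr 1
    obtain ⟨a, l⟩ := x
    by_cases ha : a = dollar
    · subst ha
      simp at h1 h
      -- `$` occurs at most once, so its repetition has length `1` and is matched by the pattern
      -- `(dollar, 1)`.
      have : l = 1 := by omega
      simp [this]
    · simp [ha]

/-! ### Runs -/

/-- The number of maximal runs of equal characters. -/
def runs : List ℕ → ℕ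
  | [] => 0
  | [_] => 1
  | a :: b :: l => (if a = b then 0 else 1) + runs (b :: l)

/-- Here `gs` collects the finished runs, and `g` the earlier members of the run that `a` currently
ends. -/
theorem length_splitBy_loop (l : List ℕ) (a : ℕ) (g : List ℕ) (gs : List (List ℕ)) :
    (List.splitBy.loop (· == ·) l a g gs).length = runs (a :: l) + gs.length := by
  induction l generalizing a g gs with
  | nil => simp [List.splitBy.loop, runs]; omega
  | cons b l ih =>
    rw [List.splitBy.loop, runs]
    by_cases h : a = b
    · simp [h, ih]
    · rw [beq_false_of_ne h]
      simp only [ih, if_neg h, List.length_cons]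
      omega

theorem length_splitBy_eq_runs (l : List ℕ) : (l.splitBy (· == ·)).length = runs l := by
  cases l with
  | nil => rfl
  | cons a l => simp [List.splitBy, length_splitBy_loop]

theorem numRuns_eq_runs (T : List ℕ) : numRuns T = runs (bwt T) := length_splitBy_eq_runs _

theorem runs_le_insert (A B : List ℕ) (c : ℕ) : runs (A ++ B) ≤ runs (A ++ c :: B) := by
  induction A with
  | nil =>
    cases B with
    | nil => simp [runs]
    | cons b B => simp [runs]
  | cons a A ih =>
    cases A with
    | nil =>
      cases B with
      | nil => simp [runs]
      | cons b B =>
        simp only [List.cons_append, List.nil_append, runs]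
        split_ifs <;> omega
    | cons a' A =>
      simp only [List.cons_append, runs] at ih ⊢
      omega

/-- The new character is a run of its own. If it falls inside a run, that run is also cut, so the
gain can be `2`. -/
theorem runs_lt_insert (A B : List ℕ) (c : ℕ) (hA : A.getLast? ≠ some c) (hB : B.head? ≠ some c) :
    runs (A ++ B) + 1 ≤ runs (A ++ c :: B) := by
  induction A with
  | nil =>
    cases B with
    | nil => simp [runs]
    | cons b B =>
      simp only [List.head?_cons, ne_eq, Option.some.injEq] at hB
      simp [runs, Ne.symm hB, add_comm]
  | cons a A ih =>
    cases A with
    | nil =>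
      simp only [List.getLast?_singleton, ne_eq, Option.some.injEq] at hA
      cases B with
      | nil => simp [runs, hA]
      | cons b B =>
        simp only [List.head?_cons, ne_eq, Option.some.injEq] at hB
        simp only [List.cons_append, List.nil_append, runs, if_neg hA,
          if_neg (Ne.symm hB)]
        split_ifs <;> omega
    | cons a' A =>
      rw [List.getLast?_cons_cons] at hA
      have := ih hA
      simp only [List.cons_append, runs] at this ⊢
      omega

theorem runs_pos {L : List ℕ} (h : L ≠ []) : 0 < runs L := by
  induction L with
  | nil => simp at h
  | cons a L ih =>
    cases L with
    | nil => simp [runs]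
    | cons b L => have := ih (by simp); simp only [runs]; omega

/-! ### The LF formula -/

theorem occLt_insert (A B : List ℕ) (c a : ℕ) :
    occLt (A ++ c :: B) a = occLt (A ++ B) a + if c < a then 1 else 0 := by
  simp [occLt, List.countP_cons]; omega

theorem rank_insert_of_le (A B : List ℕ) (c a : ℕ) {u : ℕ} (h : u ≤ A.length) :
    rank (A ++ c :: B) a u = rank (A ++ B) a u := by
  simp [rank, List.take_append_of_le_length h]

theorem rank_insert_succ (A B : List ℕ) (c a : ℕ) {u : ℕ} (h : A.length ≤ u) :
    rank (A ++ c :: B) a (u + 1) = rank (A ++ B) a u + if c = a then 1 else 0 := by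
  obtain ⟨k, rfl⟩ := Nat.exists_eq_add_of_le h
  rw [rank, rank, add_assoc, List.take_length_add_append, List.take_length_add_append]
  simp [List.count_cons]; omega

theorem getD_insert_of_lt (A B : List ℕ) (c : ℕ) {u : ℕ} (h : u < A.length) :
    (A ++ c :: B).getD u 0 = (A ++ B).getD u 0 := by
  simp [List.getD_eq_getElem?_getD, List.getElem?_append_left h]

theorem getD_insert_self (A B : List ℕ) (c : ℕ) : (A ++ c :: B).getD A.length 0 = c := by
  simp

theorem getD_insert_succ (A B : List ℕ) (c : ℕ) {u : ℕ} (h : A.length ≤ u) :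
    (A ++ c :: B).getD (u + 1) 0 = (A ++ B).getD u 0 := by
  simp only [List.getD_eq_getElem?_getD]
  rw [List.getElem?_append_right (by omega), List.getElem?_append_right h, Nat.sub_add_comm h]
  simp

theorem rank_succ (L : List ℕ) (a : ℕ) {i : ℕ} (hi : i < L.length) :
    rank L a (i + 1) = rank L a i + if L.getD i 0 = a then 1 else 0 := by
  rw [rank, rank, List.take_add_one, List.count_append, List.getD_eq_getElem _ _ hi,
    List.getElem?_eq_getElem hi, Option.toList_some, List.count_singleton]
  simp only [beq_iff_eq]

theorem rank_mono (L : List ℕ) (a : ℕ) {i j : ℕ} (h : i ≤ j) : rank L a i ≤ rank L a j :=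
  (List.take_sublist_take_left h).count_le a

theorem rank_le_count (L : List ℕ) (a i : ℕ) : rank L a i ≤ L.count a :=
  (List.take_sublist _ _).count_le a

theorem rank_lt_of_lt (L : List ℕ) {a i j : ℕ} (hi : i < L.length) (ha : L.getD i 0 = a)
    (h : i < j) : rank L a i < rank L a j := by
  have h1 := rank_succ L a hi
  have h2 := rank_mono L a (Nat.succ_le_of_lt h)
  simp only [ha, if_true] at h1
  simp only [Nat.succ_eq_add_one] at h2
  omega

theorem occLt_add_count_le (L : List ℕ) {a b : ℕ} (h : a < b) :
    occLt L a + L.count a ≤ occLt L b := by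
  induction L with
  | nil => simp [occLt]
  | cons x L ih =>
    simp only [occLt, List.countP_cons, List.count_cons, decide_eq_true_eq, beq_iff_eq] at ih ⊢
    split_ifs <;> omega

theorem occLt_add_count_le_length (L : List ℕ) (a : ℕ) : occLt L a + L.count a ≤ L.length :=
  (occLt_add_count_le L (Nat.lt_succ_self a)).trans List.countP_le_length

theorem lf_lt_occLt (L : List ℕ) {i b : ℕ} (hi : i < L.length) (h : L.getD i 0 < b) :
    lf L i < occLt L b := by
  have h1 := rank_lt_of_lt L hi rfl hi
  have h2 := rank_le_count L (L.getD i 0) L.length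
  have h3 := occLt_add_count_le L h
  rw [lf]; omega

theorem lf_lt_length (L : List ℕ) {i : ℕ} (hi : i < L.length) : lf L i < L.length :=
  (lf_lt_occLt L hi (Nat.lt_succ_self _)).trans_le List.countP_le_length

theorem lf_le_length (L : List ℕ) (i : ℕ) : lf L i ≤ L.length := by
  have h2 := rank_le_count L (L.getD i 0) i
  have h3 := occLt_add_count_le_length L (L.getD i 0)
  rw [lf]; omega

/-- LF orders the positions by character and, for equal characters, by position. -/
theorem lf_inj (L : List ℕ) {i j : ℕ} (hi : i < L.length) (hj : j < L.length)
    (h : lf L i = lf L j) : i = j := by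
  have key : ∀ {i j : ℕ}, i < L.length → j < L.length → i < j → lf L i ≠ lf L j := by
    intro i j hi hj hij
    rcases lt_trichotomy (L.getD i 0) (L.getD j 0) with h | h | h
    · have := lf_lt_occLt L hi h
      have : occLt L (L.getD j 0) ≤ lf L j := by rw [lf]; omega
      omega
    · have := rank_lt_of_lt L hi h hij
      rw [lf, lf, h]; omega
    · have := lf_lt_occLt L hj h
      have : occLt L (L.getD i 0) ≤ lf L i := by rw [lf]; omega
      omega
  rcases lt_trichotomy i j with h' | h' | h'
  · exact absurd h (key hi hj h')
  · exact h'
  · exact absurd h.symm (key hj hi h')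

/-- LF maps equal consecutive characters to consecutive positions. -/
theorem lf_add (L : List ℕ) {i k : ℕ} (hk : i + k < L.length)
    (h : ∀ j ≤ k, L.getD (i + j) 0 = L.getD i 0) : lf L (i + k) = lf L i + k := by
  induction k with
  | zero => simp
  | succ k ih =>
    have h1 := ih (by omega) fun j hj => h j (by omega)
    have h2 := rank_succ L (L.getD i 0) (i := i + k) (by omega)
    rw [lf, h k (by omega)] at h1
    rw [lf, h (k + 1) le_rfl, ← add_assoc, h2, if_pos (h k (by omega))]
    omega

/-- The position of the start of an F-interval among the rows, when the special character occupies
row `0`. The end of the string is mapped to itself. -/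
def vRow (X : List ℕ) (s : ℕ) : ℕ := if s < X.length then lf X s + 1 else s + 1

theorem vRow_of_lt {X : List ℕ} {s : ℕ} (h : s < X.length) : vRow X s = lf X s + 1 := if_pos h

/-- Rows of genuine positions are at most `X.length`, so the row `X.length + 1` given to the end of
the string is not taken. -/
theorem vRow_inj {X : List ℕ} {s t : ℕ} (hs : s ≤ X.length) (ht : t ≤ X.length)
    (h : vRow X s = vRow X t) : s = t := by
  unfold vRow at h
  split_ifs at h with h1 h2 h2
  · exact lf_inj X h1 h2 (by omega)
  · have := lf_lt_length X h1
    omega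
  · have := lf_lt_length X h2
    omega
  · omega

theorem lf_insert_dollar_self {A B : List ℕ} (h : ∀ a ∈ A ++ B, dollar < a) :
    lf (A ++ dollar :: B) A.length = 0 := by
  rw [lf, getD_insert_self, occLt_insert, rank_insert_of_le _ _ _ _ le_rfl]
  have h1 : occLt (A ++ B) dollar = 0 := by
    rw [occLt, List.countP_eq_zero]
    intro a ha
    have := h a ha
    simp; omega
  have h2 : rank (A ++ B) dollar A.length = 0 := by
    have := rank_le_count (A ++ B) dollar A.length
    rw [List.count_eq_zero.2 fun hm => (lt_irrefl _ (h _ hm))] at this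
    omega
  simp [h1, h2]

theorem getD_mem {X : List ℕ} {s : ℕ} (hs : s < X.length) : X.getD s 0 ∈ X := by
  rw [List.getD_eq_getElem _ _ hs]; exact List.getElem_mem hs

theorem lf_insert_dollar_of_lt {A B : List ℕ} (h : ∀ a ∈ A ++ B, dollar < a) {u : ℕ}
    (hu : u < A.length) : lf (A ++ dollar :: B) u = vRow (A ++ B) u := by
  have hlt : u < (A ++ B).length := by simp; omega
  have := h _ (getD_mem hlt)
  rw [vRow_of_lt hlt, lf, lf, getD_insert_of_lt _ _ _ hu, occLt_insert, if_pos this,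
    rank_insert_of_le _ _ _ _ hu.le]
  omega

theorem lf_insert_dollar_succ {A B : List ℕ} (h : ∀ a ∈ A ++ B, dollar < a) {u : ℕ}
    (hu : A.length ≤ u) (hlt : u < (A ++ B).length) :
    lf (A ++ dollar :: B) (u + 1) = vRow (A ++ B) u := by
  have := h _ (getD_mem hlt)
  rw [vRow_of_lt hlt, lf, lf, getD_insert_succ _ _ _ hu, occLt_insert, if_pos this,
    rank_insert_succ _ _ _ _ hu, if_neg this.ne]
  omega

/-! ### Insertion of a character -/

/-- The new position of a boundary after the insertion of a character at position `p`; `right` says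
that a boundary at `p` stays in front of the new character. -/
def moveBnd (p : ℕ) (right : Bool) (s : ℕ) : ℕ :=
  if s < p ∨ (s = p ∧ right = true) then s else s + 1

/-- The insertion of a character inserts a row into the F-intervals. -/
theorem vRow_insert {A B : List ℕ} {c s : ℕ} {right : Bool} (hs : s ≤ (A ++ B).length)
    (hr : right = true → B.head? = some c) :
    (vRow (A ++ B) s < occLt (A ++ B) c + rank (A ++ B) c A.length + 1 →
      vRow (A ++ c :: B) (moveBnd A.length right s) = vRow (A ++ B) s) ∧
    (occLt (A ++ B) c + rank (A ++ B) c A.length + 1 < vRow (A ++ B) s →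
      vRow (A ++ c :: B) (moveBnd A.length right s) = vRow (A ++ B) s + 1) ∧
    (vRow (A ++ B) s = occLt (A ++ B) c + rank (A ++ B) c A.length + 1 →
      vRow (A ++ c :: B) (moveBnd A.length right s) = vRow (A ++ B) s ∨
      vRow (A ++ c :: B) (moveBnd A.length right s) = vRow (A ++ B) s + 1) := by
  have hlen : (A ++ c :: B).length = (A ++ B).length + 1 := by simp; omega
  have hAB : (A ++ B).length = A.length + B.length := by simp
  have hle := occLt_add_count_le_length (A ++ B) c
  have hrc := rank_le_count (A ++ B) c A.length
  rcases hs.lt_or_eq with hlt | heq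
  · by_cases hsp : s < A.length
    · have hm : moveBnd A.length right s = s := by simp [moveBnd, hsp]
      rw [hm, vRow_of_lt hlt, vRow_of_lt (by omega), lf, lf, getD_insert_of_lt _ _ _ hsp,
        occLt_insert, rank_insert_of_le _ _ _ _ hsp.le]
      have hself : lf (A ++ B) s =
          occLt (A ++ B) ((A ++ B).getD s 0) + rank (A ++ B) ((A ++ B).getD s 0) s := rfl
      generalize ha : (A ++ B).getD s 0 = a at *
      rcases lt_trichotomy a c with h | h | h
      · rw [if_neg (by omega)]
        have := lf_lt_occLt (A ++ B) hlt (b := c) (by omega)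
        omega
      · subst h
        have := rank_lt_of_lt (A ++ B) hlt ha hsp
        simp; omega
      · have := occLt_add_count_le (A ++ B) h
        rw [if_pos h]; omega
    · by_cases hright : s = A.length ∧ right = true
      · have hm : moveBnd A.length right s = s := by simp [moveBnd, hright]
        have hc : (A ++ B).getD s 0 = c := by
          have := hr hright.2
          rw [hright.1]
          cases B with
          | nil => simp at this
          | cons b B => simpa using this
        rw [hm, vRow_of_lt hlt, vRow_of_lt (by omega), lf, lf, hc, hright.1, getD_insert_self,
          occLt_insert, rank_insert_of_le _ _ _ _ le_rfl]
        simp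
      · have hm : moveBnd A.length right s = s + 1 := by
          simp only [moveBnd]; rw [if_neg]; tauto
        have hsp' : A.length ≤ s := by omega
        rw [hm, vRow_of_lt hlt, vRow_of_lt (by omega), lf, lf, getD_insert_succ _ _ _ hsp',
          occLt_insert, rank_insert_succ _ _ _ _ hsp']
        have hself : lf (A ++ B) s =
            occLt (A ++ B) ((A ++ B).getD s 0) + rank (A ++ B) ((A ++ B).getD s 0) s := rfl
        generalize ha : (A ++ B).getD s 0 = a at *
        rcases lt_trichotomy a c with h | h | h
        · rw [if_neg (by omega), if_neg (by omega)]
          have := lf_lt_occLt (A ++ B) hlt (b := c) (by omega)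
          omega
        · subst h
          have := rank_mono (A ++ B) a hsp'
          simp; omega
        · have := occLt_add_count_le (A ++ B) h
          rw [if_pos h, if_neg (by omega)]; omega
  -- The end of the string always moves: if it sat at the insertion point with `right = true`, then
  -- `B` would be empty, contrary to `hr`.
  · have hm : moveBnd A.length right s = s + 1 := by
      simp only [moveBnd]; rw [if_neg]
      rintro (h | ⟨h, h'⟩)
      · omega
      · have := hr h'
        have hB : B = [] := List.eq_nil_of_length_eq_zero (by omega)
        simp [hB] at this
    rw [hm, vRow, vRow, if_neg (by omega), if_neg (by omega)]
    omega

/-! ### Extension of the BWT by a character -/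

/-- The character of the BWT that belongs to the suffix starting at position `i`. -/
def prevChar (S : List ℕ) (i : ℕ) : ℕ :=
  if i = 0 then S.getD (S.length - 1) 0 else S.getD (i - 1) 0

theorem bwt_eq_map (S : List ℕ) : bwt S = (suffixArray S).map (prevChar S) := rfl

/-! ### The suffix array and LF as a map on suffixes -/

theorem suffixArray_perm (S : List ℕ) : (suffixArray S).Perm (List.range S.length) :=
  List.mergeSort_perm _ _

theorem mem_suffixArray {S : List ℕ} {i : ℕ} : i ∈ suffixArray S ↔ i < S.length := by
  rw [(suffixArray_perm S).mem_iff, List.mem_range]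

theorem length_suffixArray (S : List ℕ) : (suffixArray S).length = S.length := by
  rw [(suffixArray_perm S).length_eq, List.length_range]

theorem length_bwt (S : List ℕ) : (bwt S).length = S.length := by
  rw [bwt_eq_map, List.length_map, length_suffixArray]

theorem suffixArray_pairwise_le (S : List ℕ) :
    (suffixArray S).Pairwise fun i j => S.drop i ≤ S.drop j := by
  have h := List.pairwise_mergeSort (le := fun i j => decide (S.drop i ≤ S.drop j))
    (by simp only [decide_eq_true_eq]; exact fun a b c => le_trans)
    (by simp only [Bool.or_eq_true, decide_eq_true_eq]; exact fun a b => le_total _ _)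
    (List.range S.length)
  simpa [suffixArray] using h

theorem drop_inj {S : List ℕ} {i j : ℕ} (hi : i < S.length) (hj : j < S.length)
    (h : S.drop i = S.drop j) : i = j := by
  have := congrArg List.length h
  simp only [List.length_drop] at this
  omega

theorem suffixArray_pairwise_lt (S : List ℕ) :
    (suffixArray S).Pairwise fun i j => S.drop i < S.drop j := by
  have hn : (suffixArray S).Nodup := (suffixArray_perm S).nodup_iff.2 List.nodup_range
  refine ((suffixArray_pairwise_le S).and hn).imp_of_mem ?_
  intro i j hi hj h
  refine lt_of_le_of_ne h.1 fun he => h.2 (drop_inj ?_ ?_ he)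
  · exact mem_suffixArray.1 hi
  · exact mem_suffixArray.1 hj

/-- A predicate that passes from later to earlier members holds exactly on a prefix. Applied to
sorted suffixes, this turns a count of smaller suffixes into a row. -/
theorem take_countP_eq_filter {P : ℕ → Bool} {l : List ℕ}
    (h : l.Pairwise fun a b => P b = true → P a = true) :
    l.take (l.countP P) = l.filter P ∧ l.drop (l.countP P) = l.filter fun a => !P a := by
  induction l with
  | nil => simp
  | cons a l ih =>
    rw [List.pairwise_cons] at h
    by_cases ha : P a = true
    · simp [ha, ih h.2]
    · have h1 : ∀ b ∈ l, ¬ P b = true := fun b hb hP => ha (h.1 b hb hP)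
      have h2 : l.countP P = 0 := List.countP_eq_zero.2 h1
      simp only [List.countP_cons, h2, ha]
      constructor
      · symm
        rw [List.filter_cons_of_neg ha]
        simpa using h1
      · symm
        simp only [Bool.not_eq_true] at ha h1
        simp [ha]
        exact h1

/-- The number of suffixes smaller than `Z`. -/
def numSmaller (S Z : List ℕ) : ℕ := (suffixArray S).countP fun y => decide (S.drop y < Z)

theorem numSmaller_eq_range (S Z : List ℕ) :
    numSmaller S Z = (List.range S.length).countP fun y => decide (S.drop y < Z) :=
  (suffixArray_perm S).countP_eq _

theorem pairwise_smaller (S Z : List ℕ) : (suffixArray S).Pairwise fun a b =>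
    decide (S.drop b < Z) = true → decide (S.drop a < Z) = true := by
  refine (suffixArray_pairwise_lt S).imp ?_
  intro a b hab
  simp only [decide_eq_true_eq]
  exact fun h => hab.trans h

theorem numSmaller_getElem {S : List ℕ} {i : ℕ} (hi : i < (suffixArray S).length) :
    numSmaller S (S.drop (suffixArray S)[i]) = i := by
  have h := suffixArray_pairwise_lt S
  have hsplit : suffixArray S =
      (suffixArray S).take i ++ (suffixArray S)[i] :: (suffixArray S).drop (i + 1) := by
    rw [← List.drop_eq_getElem_cons hi, List.take_append_drop]
  have hlen : ((suffixArray S).take i).length = i := by simp; omega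
  unfold numSmaller
  generalize (suffixArray S)[i] = z at *
  generalize (suffixArray S).take i = l₁ at *
  generalize (suffixArray S).drop (i + 1) = l₂ at *
  rw [hsplit] at h ⊢
  rw [List.pairwise_append, List.pairwise_cons] at h
  obtain ⟨-, ⟨h1, -⟩, h2⟩ := h
  rw [List.countP_append, List.countP_cons, List.countP_eq_length.2, List.countP_eq_zero.2]
  · simp [hlen]
  · intro b hb
    simpa using (h1 b hb).le
  · intro b hb
    simpa using h2 b hb _ List.mem_cons_self

theorem IsText.exists_length {S : List ℕ} (h : IsText S) :
    ∃ m, S.length = m + 1 ∧ S.getD m 0 = dollar ∧ ∀ i < m, dollar < S.getD i 0 := by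
  obtain ⟨S, rfl, h⟩ := h
  refine ⟨S.length, by simp, by simp, fun i hi => h _ ?_⟩
  simp [List.getD_eq_getElem?_getD, List.getElem?_append_left hi, hi]

/-- The LF mapping in terms of suffixes. -/
theorem numSmaller_cons {S : List ℕ} (hS : IsText S) {c : ℕ} (hc : dollar < c) (Z : List ℕ) :
    numSmaller S (c :: Z) = occLt (bwt S) c + rank (bwt S) c (numSmaller S Z) := by
  obtain ⟨m, hm, hlast, -⟩ := hS.exists_length
  have hocc : occLt (bwt S) c =
      (List.range S.length).countP fun i => decide (prevChar S i < c) := by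
    rw [occLt, bwt_eq_map, List.countP_map, (suffixArray_perm S).countP_eq]; rfl
  have hrank : rank (bwt S) c (numSmaller S Z) =
      (List.range S.length).countP fun i => decide (prevChar S i = c ∧ S.drop i < Z) := by
    rw [rank, bwt_eq_map, ← List.map_take, numSmaller,
      (take_countP_eq_filter (pairwise_smaller S Z)).1, List.count, List.countP_map,
      List.countP_filter, (suffixArray_perm S).countP_eq]
    congr 1
    ext i
    rw [Bool.decide_and]
    rfl
  rw [hocc, hrank, numSmaller_eq_range, hm, List.range_succ, List.countP_append,
    ← List.range_succ, List.range_succ_eq_map]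
  -- Suffix `y` is matched with row owner `y + 1`, whose preceding character is the first character
  -- of suffix `y`. The two left over are the suffix `[$]`, which is below `c :: Z`, and the owner
  -- `0`, whose character `$` is below `c`; each side counts one.
  have h0 : prevChar S 0 = dollar := by simp [prevChar, hm, ← hlast]
  have hd : S.drop m = [dollar] := by
    rw [List.drop_eq_getElem_cons (by omega), List.drop_of_length_le (by omega),
      ← hlast, List.getD_eq_getElem _ _ (by omega)]
  have h1 : ([dollar] : List ℕ) < c :: Z := by
    rw [List.cons_lt_cons_iff]; exact Or.inl hc
  simp only [List.countP_cons, List.countP_nil, List.countP_map, h0, hd, h1, hc, hc.ne]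
  have h2 : (List.range m).countP (fun y => decide (S.drop y < c :: Z)) =
      (List.range m).countP ((fun i => decide (prevChar S i < c)) ∘ Nat.succ) +
      (List.range m).countP
        ((fun i => decide (prevChar S i = c ∧ S.drop i < Z)) ∘ Nat.succ) := by
    have : ∀ l : List ℕ, (∀ y ∈ l, y < m) →
        l.countP (fun y => decide (S.drop y < c :: Z)) =
        l.countP ((fun i => decide (prevChar S i < c)) ∘ Nat.succ) +
        l.countP ((fun i => decide (prevChar S i = c ∧ S.drop i < Z)) ∘ Nat.succ) := by
      intro l hl
      induction l with
      | nil => simp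
      | cons y l ih =>
        have hy := hl y List.mem_cons_self
        rw [List.countP_cons, List.countP_cons, List.countP_cons,
          ih fun y hy => hl y (List.mem_cons_of_mem _ hy)]
        have hp : prevChar S (y + 1) = S[y] := by
          rw [prevChar, if_neg (by omega), Nat.add_sub_cancel, List.getD_eq_getElem]
        rw [List.drop_eq_getElem_cons (show y < S.length by omega)]
        simp only [Function.comp, Nat.succ_eq_add_one, hp, List.cons_lt_cons_iff, decide_eq_true_eq]
        by_cases h1 : S[y] < c
        · have : S[y] ≠ c := h1.ne
          simp [h1, this]; omega
        · by_cases h2 : S[y] = c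
          · simp [h2]; omega
          · simp [h1, h2]
    exact this _ fun y hy => List.mem_range.1 hy
  rw [h2]
  simp
  omega

/-- LF takes the row of the suffix at `z` to the row of the suffix at `z - 1`, and different
suffixes have different rows. A character other than `$` forces `z ≠ 0`. -/
theorem lf_bwt_ne {S : List ℕ} (hS : IsText S) {i : ℕ} (hi : i < (bwt S).length)
    (hc : dollar < (bwt S).getD i 0) : lf (bwt S) i ≠ i := by
  intro hfix
  obtain ⟨m, hm, hlast, -⟩ := hS.exists_length
  have hi' : i < (suffixArray S).length := by rwa [length_bwt, ← length_suffixArray] at hi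
  have hz : (suffixArray S)[i] < S.length := mem_suffixArray.1 (List.getElem_mem hi')
  have hrow := numSmaller_getElem hi'
  have hL : (bwt S).getD i 0 = prevChar S (suffixArray S)[i] := by
    rw [List.getD_eq_getElem _ _ hi]; simp [bwt_eq_map]
  generalize hzdef : (suffixArray S)[i] = z at *
  have hz0 : z ≠ 0 := by
    rintro rfl
    rw [hL, prevChar, if_pos rfl, hm, Nat.add_sub_cancel, hlast] at hc
    exact lt_irrefl _ hc
  have hp : prevChar S z = S[z - 1] := by
    rw [prevChar, if_neg hz0, List.getD_eq_getElem]
  have hdrop : S.drop (z - 1) = (bwt S).getD i 0 :: S.drop z := by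
    rw [List.drop_eq_getElem_cons (show z - 1 < S.length by omega), hL, hp,
      Nat.sub_add_cancel (by omega)]
  have h1 := numSmaller_cons hS hc (S.drop z)
  rw [hrow, ← lf, hfix, ← hdrop] at h1
  obtain ⟨j, hj, hj'⟩ := List.getElem_of_mem (mem_suffixArray.2 (show z - 1 < S.length by omega))
  have h2 := numSmaller_getElem hj
  rw [hj', h1] at h2
  have hzi := hzdef
  simp only [h2, hj'] at hzi
  omega

/-- Prepending a character does not change the old suffixes, only their starting positions. They
keep their order, and the whole new string is the only suffix added; uniqueness of a sorted
permutation finishes. -/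
theorem suffixArray_cons (S : List ℕ) (c : ℕ) :
    suffixArray (c :: S) =
      ((suffixArray S).take (numSmaller S (c :: S))).map Nat.succ ++
        0 :: ((suffixArray S).drop (numSmaller S (c :: S))).map Nat.succ := by
  obtain ⟨h1, h2⟩ := take_countP_eq_filter (pairwise_smaller S (c :: S))
  have hp := pairwise_smaller S (c :: S)
  refine List.Perm.eq_of_pairwise (le := fun i j => (c :: S).drop i ≤ (c :: S).drop j) ?_
    (suffixArray_pairwise_le _) ?_ ?_
  · intro a b ha hb hab hba
    refine drop_inj (mem_suffixArray.1 ha) ?_ (le_antisymm hab hba)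
    rcases List.mem_append.1 hb with hb | hb
    · obtain ⟨y, hy, rfl⟩ := List.mem_map.1 hb
      simpa using mem_suffixArray.1 (List.mem_of_mem_take hy)
    · rcases List.mem_cons.1 hb with rfl | hb
      · simp
      · obtain ⟨y, hy, rfl⟩ := List.mem_map.1 hb
        simpa using mem_suffixArray.1 (List.mem_of_mem_drop hy)
  · have h3 := suffixArray_pairwise_le S
    rw [← List.take_append_drop (numSmaller S (c :: S)) (suffixArray S), List.pairwise_append] at h3
    rw [List.pairwise_append, List.pairwise_cons, List.pairwise_map, List.pairwise_map]
    refine ⟨h3.1, ⟨?_, h3.2.1⟩, ?_⟩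
    · intro b hb
      obtain ⟨y, hy, rfl⟩ := List.mem_map.1 hb
      rw [numSmaller, h2] at hy
      simpa using (List.mem_filter.1 hy).2
    · intro a ha b hb
      obtain ⟨x, hx, rfl⟩ := List.mem_map.1 ha
      rcases List.mem_cons.1 hb with rfl | hb
      · rw [numSmaller, h1] at hx
        have := (List.mem_filter.1 hx).2
        simp only [decide_eq_true_eq] at this
        exact this.le
      · obtain ⟨y, hy, rfl⟩ := List.mem_map.1 hb
        exact h3.2.2 x hx y hy
  · refine (suffixArray_perm _).trans ?_
    refine List.Perm.trans ?_ List.perm_middle.symm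
    rw [← List.map_append, List.take_append_drop, List.length_cons, List.range_succ_eq_map]
    exact (((suffixArray_perm S).map _).symm.cons _)

/-- The row of `$` is the row of the suffix at `0`, which is now preceded by `c`. The added row, for
the whole new string, carries the last character `$`, and `numSmaller_cons` locates it. -/
theorem bwt_cons {S A B : List ℕ} (hS : IsText S) {c : ℕ} (hc : dollar < c)
    (hL : bwt S = A ++ dollar :: B) (hAB : ∀ a ∈ A ++ B, dollar < a) :
    bwt (c :: S) =
      (A ++ c :: B).take (occLt (bwt S) c + rank (bwt S) c A.length) ++
        dollar :: (A ++ c :: B).drop (occLt (bwt S) c + rank (bwt S) c A.length) := by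
  obtain ⟨m, hm, hlast, hgt⟩ := hS.exists_length
  have hlen : A.length < (suffixArray S).length := by
    rw [length_suffixArray, ← length_bwt S, hL]; simp
  have hzero : (suffixArray S)[A.length] = 0 := by
    have h1 : (bwt S)[A.length]? = some dollar := by rw [hL]; simp
    rw [bwt_eq_map, List.getElem?_map, List.getElem?_eq_getElem hlen] at h1
    simp only [Option.map_some, Option.some.injEq] at h1
    by_contra h0
    rw [prevChar, if_neg h0] at h1
    have := mem_suffixArray.1 (List.getElem_mem hlen)
    have := hgt ((suffixArray S)[A.length] - 1) (by omega)
    omega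
  have hrow := numSmaller_getElem hlen
  rw [hzero, List.drop_zero] at hrow
  have hins := numSmaller_cons hS hc S
  rw [hrow] at hins
  have hmap : (suffixArray S).map (prevChar (c :: S) ∘ Nat.succ) = A ++ c :: B := by
    have h1 : (suffixArray S).map (prevChar (c :: S) ∘ Nat.succ) =
        (bwt S).map fun x => if x = dollar then c else x := by
      rw [bwt_eq_map, List.map_map]
      refine List.map_congr_left fun y hy => ?_
      have hy := mem_suffixArray.1 hy
      cases y with
      | zero =>
        have h2 : prevChar S 0 = dollar := by
          rw [prevChar, if_pos rfl, hm, Nat.add_sub_cancel, hlast]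
        simp only [Function.comp, h2, if_true]
        simp [prevChar]
      | succ y =>
        have := hgt y (by omega)
        have h2 : prevChar S (y + 1) = S.getD y 0 := by simp [prevChar]
        simp only [Function.comp, h2, if_neg this.ne']
        simp [prevChar]
    rw [h1, hL, List.map_append, List.map_cons, if_pos rfl]
    congr 1
    · conv_rhs => rw [← List.map_id A]
      refine List.map_congr_left fun x hx => ?_
      have := hAB x (by simp [hx])
      simp; omega
    · congr 1
      conv_rhs => rw [← List.map_id B]
      refine List.map_congr_left fun x hx => ?_
      have := hAB x (by simp [hx])
      simp; omega
  rw [bwt_eq_map, suffixArray_cons, List.map_append, List.map_cons, List.map_map, List.map_map,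
    List.map_take, List.map_drop, hmap, hins]
  congr 2
  rw [prevChar, if_pos rfl, List.length_cons, Nat.add_sub_cancel, hm, List.getD_cons_succ, hlast]

theorem bwt_dollar : bwt [dollar] = [dollar] := by
  simp [bwt, suffixArray]

/-! ### The invariant of the algorithm -/

/-- In the string with the special character at position `p`, a boundary `s` of the string without
it is at position `s`, for `s < p`, at `s + 1`, for `p < s`, and at both for `s = p`. -/
def uLo (p s : ℕ) : ℕ := if s ≤ p then s else s + 1

def uHi (p s : ℕ) : ℕ := if s < p then s else s + 1

theorem uLo_le_uHi (p s : ℕ) : uLo p s ≤ uHi p s := by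
  unfold uLo uHi; split_ifs <;> omega

theorem separated_u (p : ℕ) (I : Finset ℕ) : Separated (uLo p) (uHi p) I := by
  refine ⟨fun s _ => uLo_le_uHi p s, fun s _ s' _ h => ?_⟩
  unfold uLo uHi
  split_ifs <;> omega

theorem separated_v {X : List ℕ} {I : Finset ℕ} (hI : ∀ s ∈ I, s ≤ X.length) :
    Separated (vRow X) (vRow X) I := by
  refine ⟨fun s _ => le_rfl, fun s hs s' hs' h => ?_⟩
  exact lt_or_gt_of_ne fun he => h (vRow_inj (hI s hs) (hI s' hs') he)

/-- Both directions are needed: the first sum pays for cutting heavy repetitions, the second for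
cutting heavy F-intervals. -/
def totalPotential (X : List ℕ) (p : ℕ) (S : Finset ℕ) : ℕ :=
  potential (uLo p) (uHi p) (vRow X) (vRow X) S S + potential (vRow X) (vRow X) (uLo p) (uHi p) S S

theorem totalPotential_le {X : List ℕ} {p : ℕ} {S : Finset ℕ} (hS : ∀ s ∈ S, s ≤ X.length) :
    totalPotential X p S ≤ 2 * S.card := by
  have h1 := potential_le_card (lo' := vRow X) (hi' := vRow X) (J := S) (separated_u p S)
    fun _ _ => le_rfl
  have h2 := potential_le_card (lo' := uLo p) (hi' := uHi p) (J := S) (separated_v hS)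
    fun t _ => uLo_le_uHi p t
  unfold totalPotential; omega

theorem totalPotential_le_insert {X : List ℕ} {p e : ℕ} {S : Finset ℕ}
    (hS : ∀ s ∈ S, s ≤ X.length) (he : e ≤ X.length) :
    totalPotential X p S ≤ totalPotential X p (insert e S) + 8 := by
  have hS' : ∀ s ∈ insert e S, s ≤ X.length := by simpa [he] using hS
  have h1 := potential_le_insert_add (lo' := vRow X) (hi' := vRow X) (J := S)
    (separated_u p (insert e S))
  have h2 := potential_le_insert_add (lo' := uLo p) (hi' := uHi p) (J := S) (separated_v hS')
  have h3 := potential_mono_right (lo := uLo p) (hi := uHi p) (lo' := vRow X) (hi' := vRow X)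
    (I := insert e S) (Finset.subset_insert e S)
  have h4 := potential_mono_right (lo := vRow X) (hi := vRow X) (lo' := uLo p) (hi' := uHi p)
    (I := insert e S) (Finset.subset_insert e S)
  unfold totalPotential; omega

/-- Splitting a repetition with many starts of F-intervals. -/
theorem totalPotential_cutU {X : List ℕ} {p e : ℕ} {S A B : Finset ℕ}
    (hS : ∀ s ∈ S, s ≤ X.length) (he : e ≤ X.length) (heS : e ∉ S)
    (hA : A ⊆ S) (hB : B ⊆ S) (hA4 : 4 ≤ A.card) (hB4 : 4 ≤ B.card)
    (hA' : ∀ t ∈ A, vRow X t < uLo p e ∧ ∀ s ∈ S, uHi p s < uLo p e → uHi p s < vRow X t)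
    (hB' : ∀ t ∈ B, uHi p e < vRow X t ∧ ∀ s ∈ S, uHi p e < uLo p s → vRow X t < uLo p s) :
    totalPotential X p S + 3 ≤ totalPotential X p (insert e S) := by
  have hS' : ∀ s ∈ insert e S, s ≤ X.length := by simpa [he] using hS
  have h1 := potential_add_four_le_insert heS (separated_u p (insert e S)) hA hB hA4 hB4 hA' hB'
  have h2 := potential_mono_right (lo := uLo p) (hi := uHi p) (lo' := vRow X) (hi' := vRow X)
    (I := insert e S) (Finset.subset_insert e S)
  have h3 := potential_mono_right (lo := vRow X) (hi := vRow X) (lo' := uLo p) (hi' := uHi p)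
    (I := S) (Finset.subset_insert e S)
  -- On the F-axis `e` is a single row, and the disjoint intervals of the other axis contain it at
  -- most once.
  have h4 := potential_le_insert_add_one (lo' := uLo p) (hi' := uHi p) (J := insert e S) heS
    (separated_v hS') (by
      intro t ht t' ht' a b c d
      by_contra hne
      rcases (separated_u p (insert e S)).2 t ht t' ht' hne with h | h <;> omega)
  unfold totalPotential; omega

/-- Splitting an F-interval with many starts of repetitions. -/
theorem totalPotential_cutV {X : List ℕ} {p e : ℕ} {S A B : Finset ℕ}
    (hS : ∀ s ∈ S, s ≤ X.length) (he : e ≤ X.length) (heS : e ∉ S) (hep : e ≠ p)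
    (hA : A ⊆ S) (hB : B ⊆ S) (hA4 : 4 ≤ A.card) (hB4 : 4 ≤ B.card)
    (hA' : ∀ t ∈ A, uHi p t < vRow X e ∧ ∀ s ∈ S, vRow X s < vRow X e → vRow X s < uLo p t)
    (hB' : ∀ t ∈ B, vRow X e < uLo p t ∧ ∀ s ∈ S, vRow X e < vRow X s → uHi p t < vRow X s) :
    totalPotential X p S + 3 ≤ totalPotential X p (insert e S) := by
  have hS' : ∀ s ∈ insert e S, s ≤ X.length := by simpa [he] using hS
  have h1 := potential_add_four_le_insert heS (separated_v hS') hA hB hA4 hB4 hA' hB'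
  have h2 := potential_mono_right (lo := vRow X) (hi := vRow X) (lo' := uLo p) (hi' := uHi p)
    (I := insert e S) (Finset.subset_insert e S)
  have h3 := potential_mono_right (lo := uLo p) (hi := uHi p) (lo' := vRow X) (hi' := vRow X)
    (I := S) (Finset.subset_insert e S)
  -- Since `e ≠ p`, `e` is a single point among the positions and can coincide with only one row.
  -- The two-point interval at `p` could meet two.
  have h4 := potential_le_insert_add_one (lo' := vRow X) (hi' := vRow X) (J := insert e S) heS
    (separated_u p (insert e S)) (by
      intro t ht t' ht' a b c d
      have : uLo p e = uHi p e := by unfold uLo uHi; split_ifs <;> omega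
      exact vRow_inj (hS' t ht) (hS' t' ht') (by omega))
  unfold totalPotential; omega

/-- Replacing `$` by `c` shrinks the interval at the old position to one of its ends, which breaks
no strict relation. The new `$` among the positions and the new row of `c` are then inserted at the
same coordinate; a position or row just there may be stretched or shifted by one, but whatever was
strictly on one side of it stays there. -/
theorem totalPotential_le_image {A B : List ℕ} {c : ℕ} {S : Finset ℕ} {right : Bool}
    (hS : ∀ s ∈ S, s ≤ (A ++ B).length) (hr : right = true → B.head? = some c) :
    totalPotential (A ++ B) A.length S ≤
      totalPotential (A ++ c :: B) (occLt (A ++ B) c + rank (A ++ B) c A.length + 1)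
        (S.image (moveBnd A.length right)) := by
  have hinj : Set.InjOn (moveBnd A.length right) S := by
    intro s _ t _ h
    simp only [moveBnd] at h
    split_ifs at h <;> omega
  -- The moved boundary is one of the ends of its old interval, whichever side the new `c` joins.
  have hmove : ∀ s, uLo A.length s ≤ moveBnd A.length right s ∧
      moveBnd A.length right s ≤ uHi A.length s := by
    intro s
    unfold uLo uHi moveBnd
    split_ifs <;> omega
  have hv : ∀ s ∈ S, _ := fun s hs => vRow_insert (c := c) (right := right) (hS s hs) hr
  have h1 : ∀ s ∈ S, ∀ t ∈ S, uHi A.length s < vRow (A ++ B) t →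
      uHi (occLt (A ++ B) c + rank (A ++ B) c A.length + 1) (moveBnd A.length right s) <
        vRow (A ++ c :: B) (moveBnd A.length right t) := by
    intro s hs t ht h
    have h1 := hmove s
    have h2 := hv t ht
    generalize occLt (A ++ B) c + rank (A ++ B) c A.length + 1 = p at *
    generalize moveBnd A.length right s = x at *
    unfold uHi at h h1 ⊢
    split_ifs at * <;> omega
  have h2 : ∀ s ∈ S, ∀ t ∈ S, vRow (A ++ B) t < uLo A.length s →
      vRow (A ++ c :: B) (moveBnd A.length right t) <
        uLo (occLt (A ++ B) c + rank (A ++ B) c A.length + 1) (moveBnd A.length right s) := by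
    intro s hs t ht h
    have h1 := hmove s
    have h2 := hv t ht
    generalize occLt (A ++ B) c + rank (A ++ B) c A.length + 1 = p at *
    generalize moveBnd A.length right s = x at *
    unfold uLo at h h1 ⊢
    split_ifs at * <;> omega
  refine Nat.add_le_add (potential_le_image hinj ?_ h1 h2) (potential_le_image hinj ?_ ?_ ?_)
  · intro s hs t ht h
    rcases lt_trichotomy s t with h' | rfl | h'
    · unfold uHi uLo; split_ifs <;> omega
    · have := uLo_le_uHi (occLt (A ++ B) c + rank (A ++ B) c A.length + 1)
        (moveBnd A.length right s)
      omega
    · have h3 : moveBnd A.length right t ≤ moveBnd A.length right s := by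
        unfold moveBnd; split_ifs <;> omega
      unfold uHi uLo at h
      split_ifs at h <;> omega
  · intro s hs t ht h
    have h1 := hv s hs
    have h2 := hv t ht
    rcases lt_trichotomy (vRow (A ++ B) s) (vRow (A ++ B) t) with h' | h' | h'
    · exact h'
    · have := vRow_inj (hS s hs) (hS t ht) h'
      subst this; omega
    · omega
  · intro t ht s hs h
    exact h2 s hs t ht h
  · intro t ht s hs h
    exact h1 s hs t ht h

/-- `S` is the set of boundaries that remain when the special character is removed from the string
of `D` and a repetition split by its insertion (as told by `b`) is restored. -/
structure Reduces (D : DBWT) (b : Bool) (A B : List ℕ) (S : Finset ℕ) : Prop where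
  pos : Pos D
  expand_eq : expand D = A ++ dollar :: B
  gt : ∀ a ∈ A ++ B, dollar < a
  le : ∀ s ∈ S, s ≤ (A ++ B).length
  -- A repetition is cut by `$` exactly if the place of `$` in `X` is no boundary.
  flag : b = true ↔ A.length ∉ S
  -- Removing a boundary outside `S` is harmless, since equal characters stand on both sides of it.
  run : ∀ s ≤ (A ++ B).length, s ∉ S → 0 < s ∧ (A ++ B)[s - 1]? = (A ++ B)[s]?
  mem_bnd : ∀ q, q ∈ bnd D ↔ q = A.length ∨ q = A.length + 1 ∨ (q < A.length ∧ q ∈ S) ∨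
    (A.length + 1 < q ∧ q - 1 ∈ S)
  bound : 3 * S.card ≤ totalPotential (A ++ B) A.length S + 22 * runs (A ++ B) + 3

theorem Reduces.size_eq {D : DBWT} {b : Bool} {A B : List ℕ} {S : Finset ℕ}
    (h : Reduces D b A B S) : size D = (A ++ B).length + 1 := by
  rw [← length_expand, h.expand_eq]; simp; omega

/-- Restoring `$` adds at most the two ends of its node to `S`, and `bnd D` has one element more
than `D` has nodes. The invariant and `totalPotential ≤ 2 * S.card` leave `S.card ≤ 22 * runs + 3`.
-/
theorem Reduces.length_le {D : DBWT} {b : Bool} {A B : List ℕ} {S : Finset ℕ}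
    (h : Reduces D b A B S) : D.length ≤ 22 * runs (A ++ B) + 4 := by
  have h1 := card_bnd h.pos
  have hsub : bnd D ⊆
      insert A.length (insert (A.length + 1)
        (S.image fun s => if s < A.length then s else s + 1)) := by
    intro q hq
    rw [h.mem_bnd] at hq
    simp only [Finset.mem_insert, Finset.mem_image]
    rcases hq with hq | hq | ⟨hq, hq'⟩ | ⟨hq, hq'⟩
    · exact Or.inl hq
    · exact Or.inr (Or.inl hq)
    · exact Or.inr (Or.inr ⟨q, hq', by simp [hq]⟩)
    · exact Or.inr (Or.inr ⟨q - 1, hq', by rw [if_neg (by omega)]; omega⟩)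
  have h2 := Finset.card_le_card hsub
  have h3 := Finset.card_insert_le A.length
    (insert (A.length + 1) (S.image fun s => if s < A.length then s else s + 1))
  have h4 := Finset.card_insert_le (A.length + 1)
    (S.image fun s => if s < A.length then s else s + 1)
  have h5 := Finset.card_image_le (s := S) (f := fun s => if s < A.length then s else s + 1)
  have h6 := h.bound
  have h7 := totalPotential_le (p := A.length) h.le
  omega

/-! ### Balancing -/

/-- The boundary of the string without the special character at position `p` that corresponds to
the boundary `q`. -/
def unshift (p q : ℕ) : ℕ := if q < p then q else q - 1

theorem Reduces.cutAt {D : DBWT} {b : Bool} {A B : List ℕ} {S : Finset ℕ}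
    (h : Reduces D b A B S) {q : ℕ} (hq : q < size D) (hqD : q ∉ bnd D)
    (hpot : totalPotential (A ++ B) A.length S + 3 ≤
      totalPotential (A ++ B) A.length (insert (unshift A.length q) S)) :
    Reduces (RComp.cutAt D q) b A B (insert (unshift A.length q) S) where
  pos := pos_cutAt h.pos q
  expand_eq := by rw [expand_cutAt, h.expand_eq]
  gt := h.gt
  le := by
    intro s hs
    rcases Finset.mem_insert.1 hs with rfl | hs
    · rw [h.size_eq] at hq
      have := h.mem_bnd q
      unfold unshift; split_ifs <;> simp at hq ⊢ <;> omega
    · exact h.le s hs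
  flag := by
    have := h.mem_bnd q
    rw [h.flag, Finset.mem_insert]
    -- The cut is at neither end of the node of `$`, so it does not become a boundary at the place
    -- of `$`, and the flag stays valid.
    have hne : A.length ≠ unshift A.length q := by
      unfold unshift; split_ifs <;> grind
    tauto
  run := fun s hs hs' => h.run s hs fun hm => hs' (Finset.mem_insert_of_mem hm)
  mem_bnd := by
    intro r
    have hq1 := h.mem_bnd q
    have hr1 := h.mem_bnd r
    rw [bnd_cutAt hq.le, Finset.mem_insert, Finset.mem_insert, Finset.mem_insert]
    unfold unshift
    grind
  bound := by
    have h1 := h.bound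
    have h2 := Finset.card_insert_le (unshift A.length q) S
    omega

/-- A strictly increasing list with at least `16` members is split by its median. -/
theorem exists_halves {Q : List ℕ} (hQ : Q.Pairwise (· < ·)) (h16 : 16 ≤ Q.length) :
    ∃ l r : Finset ℕ, 7 ≤ l.card ∧ 7 ≤ r.card ∧
      (∀ x ∈ l, x ∈ Q ∧ (∃ y ∈ Q, y < x) ∧ x < Q.getD ((Q.length + 1) / 2) 0) ∧
      (∀ x ∈ r, x ∈ Q ∧ Q.getD ((Q.length + 1) / 2) 0 < x) ∧
      Q.getD ((Q.length + 1) / 2) 0 ∈ Q := by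
  have hn : Q.Nodup := hQ.imp fun h => h.ne
  have hlt : (Q.length + 1) / 2 < Q.length := by omega
  have hget : ∀ i j, (hi : i < Q.length) → (hj : j < Q.length) → i < j → Q[i] < Q[j] :=
    fun i j hi hj hij => List.pairwise_iff_getElem.1 hQ i j hi hj hij
  -- The first member is left out because it may coincide with the start of the interval, while the
  -- potential counts strict inclusions. The median is left out as the cut itself. With `16`
  -- members, `7` remain on either side.
  refine ⟨((Q.take ((Q.length + 1) / 2)).drop 1).toFinset,
    (Q.drop ((Q.length + 1) / 2 + 1)).toFinset, ?_, ?_, ?_, ?_, ?_⟩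
  · rw [List.toFinset_card_of_nodup]
    · simp; omega
    · exact hn.sublist ((List.drop_sublist _ _).trans (List.take_sublist _ _))
  · rw [List.toFinset_card_of_nodup]
    · simp; omega
    · exact hn.sublist (List.drop_sublist _ _)
  · intro x hx
    rw [List.mem_toFinset] at hx
    obtain ⟨i, hi, rfl⟩ := List.getElem_of_mem hx
    simp only [List.length_drop, List.length_take] at hi
    rw [List.getD_eq_getElem _ _ hlt]
    simp only [List.getElem_drop, List.getElem_take]
    exact ⟨List.getElem_mem _, ⟨Q[0], List.getElem_mem _, hget _ _ _ _ (by omega)⟩,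
      hget _ _ _ _ (by omega)⟩
  · intro x hx
    rw [List.mem_toFinset] at hx
    obtain ⟨i, hi, rfl⟩ := List.getElem_of_mem hx
    rw [List.getD_eq_getElem _ _ hlt]
    simp only [List.getElem_drop]
    exact ⟨List.getElem_mem _, hget _ _ _ _ (by omega)⟩
  · rw [List.getD_eq_getElem _ _ hlt]
    exact List.getElem_mem _

theorem pairwise_lt_mergeSort {l : List ℕ} (h : l.Nodup) : l.mergeSort.Pairwise (· < ·) := by
  have h1 : l.mergeSort.Pairwise (· ≤ ·) := by
    have := List.pairwise_mergeSort (le := fun a b : ℕ => decide (a ≤ b))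
      (by simp; omega) (by simp; omega) l
    simpa using this
  have h2 : l.mergeSort.Nodup := (List.mergeSort_perm l _).nodup_iff.2 h
  exact (h1.and h2).imp fun h => lt_of_le_of_ne h.1 h.2

theorem vStart_inj {D : DBWT} (h : Pos D) {i j : ℕ} (hi : i < D.length) (hj : j < D.length)
    (he : vStart D i = vStart D j) : i = j :=
  uStart_inj h hi hj (lf_inj _ (by rw [length_expand]; exact uStart_lt_size h hi)
    (by rw [length_expand]; exact uStart_lt_size h hj) he)

theorem coveredByU_pairwise {D : DBWT} (h : Pos D) (i : ℕ) :
    (coveredByU D i).Pairwise (· < ·) := by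
  refine pairwise_lt_mergeSort (List.Nodup.filter _ ?_)
  refine List.Nodup.map_on ?_ List.nodup_range
  intro a ha b hb hab
  exact vStart_inj h (List.mem_range.1 ha) (List.mem_range.1 hb) hab

theorem coveredByV_pairwise {D : DBWT} (h : Pos D) (i : ℕ) :
    (coveredByV D i).Pairwise (· < ·) := by
  refine pairwise_lt_mergeSort (List.Nodup.filter _ ?_)
  refine List.Nodup.map_on ?_ List.nodup_range
  intro a ha b hb hab
  exact uStart_inj h (List.mem_range.1 ha) (List.mem_range.1 hb) hab

theorem mem_coveredByU {D : DBWT} {i x : ℕ} : x ∈ coveredByU D i ↔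
    (∃ j < D.length, vStart D j = x) ∧ uStart D i ≤ x ∧ x < uStart D i + len D i := by
  simp [coveredByU]

theorem mem_coveredByV {D : DBWT} {i x : ℕ} : x ∈ coveredByV D i ↔
    (∃ j < D.length, uStart D j = x) ∧ vStart D i ≤ x ∧ x < vStart D i + len D i := by
  simp [coveredByV]

/-- Two exceptional values `x` and `y` are allowed: the starting positions caused by the node of
`$`, which need not come from `S`. Of `7` values, at least `5` are left. -/
theorem four_le_card_of_subset_image {l : Finset ℕ} {P : Finset ℕ} {f : ℕ → ℕ} (x y : ℕ)
    (hl : 7 ≤ l.card) (h : ∀ z ∈ l, z ≠ x → z ≠ y → ∃ t ∈ P, f t = z) : 4 ≤ P.card := by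
  have hsub : l ⊆ insert x (insert y (P.image f)) := by
    intro z hz
    simp only [Finset.mem_insert, Finset.mem_image]
    by_cases hx : z = x
    · exact Or.inl hx
    by_cases hy : z = y
    · exact Or.inr (Or.inl hy)
    · exact Or.inr (Or.inr (h z hz hx hy))
  have h1 := Finset.card_le_card hsub
  have h2 := Finset.card_insert_le x (insert y (P.image f))
  have h3 := Finset.card_insert_le y (P.image f)
  have h4 := Finset.card_image_le (s := P) (f := f)
  omega

theorem Reduces.uLo_mem {D : DBWT} {b : Bool} {A B : List ℕ} {S : Finset ℕ}
    (h : Reduces D b A B S) {s : ℕ} (hs : s ∈ S) : uLo A.length s ∈ bnd D := by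
  rw [h.mem_bnd, uLo]
  grind

theorem Reduces.uHi_mem {D : DBWT} {b : Bool} {A B : List ℕ} {S : Finset ℕ}
    (h : Reduces D b A B S) {s : ℕ} (hs : s ∈ S) : uHi A.length s ∈ bnd D := by
  rw [h.mem_bnd, uHi]
  grind

theorem Reduces.lf_eq_vRow {D : DBWT} {b : Bool} {A B : List ℕ} {S : Finset ℕ}
    (h : Reduces D b A B S) {u : ℕ} (hu : u < size D) (hup : u ≠ A.length) :
    lf (expand D) u = vRow (A ++ B) (unshift A.length u) := by
  rw [h.expand_eq, unshift]
  rw [h.size_eq] at hu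
  split_ifs with h1
  · exact lf_insert_dollar_of_lt h.gt h1
  · obtain ⟨v, rfl⟩ : ∃ v, u = v + 1 := ⟨u - 1, by omega⟩
    exact lf_insert_dollar_succ h.gt (by omega) (by omega)

theorem Reduces.vRow_eq_lf {D : DBWT} {b : Bool} {A B : List ℕ} {S : Finset ℕ}
    (h : Reduces D b A B S) {s : ℕ} (hs : s < (A ++ B).length) :
    vRow (A ++ B) s = lf (expand D) (uHi A.length s) := by
  rw [h.expand_eq, uHi]
  split_ifs with h1
  · exact (lf_insert_dollar_of_lt h.gt h1).symm
  · exact (lf_insert_dollar_succ h.gt (by omega) hs).symm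

/-- No boundary lies inside the heavy repetition, so the covered starts on either side of the median
lie in one gap each, and enough of them come from `S` to fill both parts up to the cap. -/
theorem Reduces.cutU {α : ℕ} {D : DBWT} {b : Bool} {A B : List ℕ} {S : Finset ℕ}
    (h : Reduces D b A B S) (hα : 16 ≤ α) {i : ℕ} (hi : HeavyU α D i) :
    Reduces (RComp.cutAt D (RComp.cutU D i)) b A B
      (insert (unshift A.length (RComp.cutU D i)) S) := by
  obtain ⟨hi, hheavy⟩ := hi
  obtain ⟨l, r, hl7, hr7, hl, hr, hq⟩ :=
    exists_halves (coveredByU_pairwise h.pos i) (hα.trans hheavy)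
  change ∀ x ∈ l, x ∈ coveredByU D i ∧ _ ∧ x < RComp.cutU D i at hl
  change ∀ x ∈ r, x ∈ coveredByU D i ∧ RComp.cutU D i < x at hr
  change RComp.cutU D i ∈ coveredByU D i at hq
  generalize RComp.cutU D i = q at *
  have hsize : uStart D i + len D i ≤ size D := by
    rw [← uStart_succ D hi]; exact uStart_le_size D _
  simp only [mem_coveredByU] at hl hr hq
  obtain ⟨x₀, hx₀⟩ : l.Nonempty := Finset.card_pos.1 (by omega)
  have hx₀' := hl x₀ hx₀
  have hqD : q ∉ bnd D := by
    intro hm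
    have := le_or_le_of_mem_bnd hi hm
    omega
  have hne : q ≠ A.length ∧ q ≠ A.length + 1 := by
    rw [h.mem_bnd] at hqD; tauto
  have hlo : uLo A.length (unshift A.length q) = q := by
    unfold uLo unshift; split_ifs <;> omega
  have hhi : uHi A.length (unshift A.length q) = q := by
    unfold uHi unshift; split_ifs <;> omega
  -- The exceptions are row `0`, the F-interval of `$` itself, and the F-interval of the repetition
  -- that begins right after `$`, whose boundary may be an artefact of the insertion of `$`.
  have hcov : ∀ z : ℕ, (∃ j < D.length, vStart D j = z) → z ≠ 0 →
      z ≠ lf (expand D) (A.length + 1) → ∃ t ∈ S, vRow (A ++ B) t = z := by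
    rintro z ⟨j, hj, rfl⟩ h0 h1
    have hm := (h.mem_bnd _).1 (uStart_mem_bnd D j)
    have hp : uStart D j ≠ A.length := by
      intro he
      rw [vStart, he, h.expand_eq, lf_insert_dollar_self h.gt] at h0
      exact h0 rfl
    have hp' : uStart D j ≠ A.length + 1 := fun he => h1 (by rw [vStart, he])
    refine ⟨unshift A.length (uStart D j), ?_, ?_⟩
    · unfold unshift; split_ifs <;> grind
    · rw [vStart, h.lf_eq_vRow (uStart_lt_size h.pos hj) hp]
  refine h.cutAt (by omega) hqD ?_
  refine totalPotential_cutU (A := S.filter fun t => vRow (A ++ B) t ∈ l)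
    (B := S.filter fun t => vRow (A ++ B) t ∈ r) h.le ?_ ?_ (Finset.filter_subset _ _)
    (Finset.filter_subset _ _) ?_ ?_ ?_ ?_
  · have := h.size_eq
    unfold unshift; split_ifs <;> omega
  · intro hm
    rw [h.mem_bnd, unshift] at *
    split_ifs at hm <;> grind
  · refine four_le_card_of_subset_image (f := vRow (A ++ B)) 0 (lf (expand D) (A.length + 1)) hl7 ?_
    intro z hz h0 h1
    obtain ⟨t, ht, rfl⟩ := hcov z (hl z hz).1.1 h0 h1
    exact ⟨t, Finset.mem_filter.2 ⟨ht, hz⟩, rfl⟩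
  · refine four_le_card_of_subset_image (f := vRow (A ++ B)) 0 (lf (expand D) (A.length + 1)) hr7 ?_
    intro z hz h0 h1
    obtain ⟨t, ht, rfl⟩ := hcov z (hr z hz).1.1 h0 h1
    exact ⟨t, Finset.mem_filter.2 ⟨ht, hz⟩, rfl⟩
  · intro t ht
    obtain ⟨ht, htl⟩ := Finset.mem_filter.1 ht
    obtain ⟨h1, ⟨y, hy, hyx⟩, h2⟩ := hl _ htl
    rw [hlo]
    refine ⟨h2, fun s hs hsq => ?_⟩
    have := le_or_le_of_mem_bnd hi (h.uHi_mem hs)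
    omega
  · intro t ht
    obtain ⟨ht, htr⟩ := Finset.mem_filter.1 ht
    obtain ⟨h1, h2⟩ := hr _ htr
    rw [hhi]
    refine ⟨h2, fun s hs hsq => ?_⟩
    have := le_or_le_of_mem_bnd hi (h.uLo_mem hs)
    omega

theorem lf_uStart_add {D : DBWT} {i : ℕ} (hi : i < D.length) {k : ℕ} (hk : k < len D i) :
    lf (expand D) (uStart D i + k) = vStart D i + k := by
  have hsize : uStart D i + len D i ≤ size D := by
    rw [← uStart_succ D hi]; exact uStart_le_size D _
  refine lf_add _ (by rw [length_expand]; omega) fun j hj => ?_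
  rw [List.getD_eq_getElem?_getD, List.getD_eq_getElem?_getD,
    getElem?_expand_of_mem hi (by omega) (by omega), getElem?_expand_of_mem hi le_rfl (by omega)]

/-- This is the dual of `Reduces.cutU`. LF is a translation on the repetition, so the transferred
cut has exactly the median as its row. -/
theorem Reduces.cutV {α : ℕ} {D : DBWT} {b : Bool} {A B : List ℕ} {S : Finset ℕ}
    (h : Reduces D b A B S) (hα : 16 ≤ α) {i : ℕ} (hi : HeavyV α D i) :
    Reduces (RComp.cutAt D (RComp.cutV D i)) b A B
      (insert (unshift A.length (RComp.cutV D i)) S) := by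
  obtain ⟨hi, hheavy⟩ := hi
  obtain ⟨l, r, hl7, hr7, hl, hr, hq⟩ :=
    exists_halves (coveredByV_pairwise h.pos i) (hα.trans hheavy)
  rw [RComp.cutV]
  generalize (coveredByV D i).getD (((coveredByV D i).length + 1) / 2) 0 = v at *
  have hsize : uStart D i + len D i ≤ size D := by
    rw [← uStart_succ D hi]; exact uStart_le_size D _
  simp only [mem_coveredByV] at hl hr hq
  obtain ⟨x₀, hx₀⟩ : l.Nonempty := Finset.card_pos.1 (by omega)
  have hx₀' := hl x₀ hx₀
  generalize hk : v - vStart D i = k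
  have hv : v = vStart D i + k := by omega
  have hlf := lf_uStart_add hi (k := k) (by omega)
  have hqD : uStart D i + k ∉ bnd D := by
    intro hm
    have := le_or_le_of_mem_bnd hi hm
    omega
  have hne : uStart D i + k ≠ A.length ∧ uStart D i + k ≠ A.length + 1 := by
    rw [h.mem_bnd] at hqD; tauto
  have hve : vRow (A ++ B) (unshift A.length (uStart D i + k)) = v := by
    rw [← h.lf_eq_vRow (by omega) hne.1, hlf, hv]
  have hout : ∀ s ∈ S, vRow (A ++ B) s ≤ vStart D i ∨ vStart D i + len D i ≤ vRow (A ++ B) s := by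
    intro s hs
    rcases (h.le s hs).lt_or_eq with hlt | heq
    -- A row strictly inside the F-interval is the image of a position strictly inside the
    -- repetition, where by injectivity of LF there can be no boundary.
    · by_contra! hcon
      rw [h.vRow_eq_lf hlt] at hcon
      have h1 := lf_uStart_add hi (k := lf (expand D) (uHi A.length s) - vStart D i) (by omega)
      rw [show vStart D i + (lf (expand D) (uHi A.length s) - vStart D i) =
        lf (expand D) (uHi A.length s) by omega] at h1
      have h2 := lf_inj _ (by rw [length_expand]; omega)
        (by rw [length_expand, h.size_eq]; unfold uHi; split_ifs <;> omega) h1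
      have := le_or_le_of_mem_bnd hi (h.uHi_mem hs)
      omega
    -- The end of the string has the row after all genuine rows.
    · right
      have h1 := lf_uStart_add hi (k := len D i - 1) (by omega)
      have h2 := lf_lt_length (expand D) (i := uStart D i + (len D i - 1))
        (by rw [length_expand]; omega)
      rw [length_expand, h.size_eq] at h2
      rw [vRow, if_neg (by omega)]
      omega
  -- The exceptions are the two ends of the node of `$`. Requiring `t ≠ A.length` makes the interval
  -- of `t` a single point.
  have hcov : ∀ z : ℕ, (∃ j < D.length, uStart D j = z) → z ≠ A.length → z ≠ A.length + 1 →
      ∃ t ∈ S, t ≠ A.length ∧ uLo A.length t = z := by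
    rintro z ⟨j, hj, rfl⟩ h0 h1
    have hm := (h.mem_bnd _).1 (uStart_mem_bnd D j)
    refine ⟨unshift A.length (uStart D j), ?_, ?_, ?_⟩
    · unfold unshift; split_ifs <;> grind
    · unfold unshift; split_ifs <;> omega
    · unfold uLo unshift; split_ifs <;> omega
  have huu : ∀ t, t ≠ A.length → uHi A.length t = uLo A.length t := by
    intro t ht
    unfold uHi uLo; split_ifs <;> omega
  refine h.cutAt (by omega) hqD ?_
  refine totalPotential_cutV (A := S.filter fun t => t ≠ A.length ∧ uLo A.length t ∈ l)
    (B := S.filter fun t => t ≠ A.length ∧ uLo A.length t ∈ r) h.le ?_ ?_ ?_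
    (Finset.filter_subset _ _) (Finset.filter_subset _ _) ?_ ?_ ?_ ?_
  · have := h.size_eq
    unfold unshift; split_ifs <;> omega
  · intro hm
    rw [h.mem_bnd, unshift] at *
    split_ifs at hm <;> grind
  · unfold unshift; split_ifs <;> omega
  · refine four_le_card_of_subset_image (f := uLo A.length) A.length (A.length + 1) hl7 ?_
    intro z hz h0 h1
    obtain ⟨t, ht, ht', rfl⟩ := hcov z (hl z hz).1.1 h0 h1
    exact ⟨t, Finset.mem_filter.2 ⟨ht, ht', hz⟩, rfl⟩
  · refine four_le_card_of_subset_image (f := uLo A.length) A.length (A.length + 1) hr7 ?_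
    intro z hz h0 h1
    obtain ⟨t, ht, ht', rfl⟩ := hcov z (hr z hz).1.1 h0 h1
    exact ⟨t, Finset.mem_filter.2 ⟨ht, ht', hz⟩, rfl⟩
  · intro t ht
    obtain ⟨ht, hp, htl⟩ := Finset.mem_filter.1 ht
    obtain ⟨h1, ⟨y, hy, hyx⟩, h2⟩ := hl _ htl
    rw [hve, huu t hp]
    refine ⟨h2, fun s hs hsq => ?_⟩
    have := hout s hs
    omega
  · intro t ht
    obtain ⟨ht, hp, htr⟩ := Finset.mem_filter.1 ht
    obtain ⟨h1, h2⟩ := hr _ htr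
    rw [hve, huu t hp]
    refine ⟨h2, fun s hs hsq => ?_⟩
    have := hout s hs
    omega

theorem Reduces.balance {α : ℕ} {D D' : DBWT} {b : Bool} {A B : List ℕ} {S : Finset ℕ}
    (h : Reduces D b A B S) (hα : 16 ≤ α) (hD : Relation.ReflTransGen (BalanceStep α) D D') :
    ∃ S', Reduces D' b A B S' := by
  induction hD with
  | refl => exact ⟨S, h⟩
  | tail _ hstep ih =>
    obtain ⟨S', h'⟩ := ih
    cases hstep with
    | caseU i hi => exact ⟨_, h'.cutU hα hi⟩
    | caseV i _ hi => exact ⟨_, h'.cutV hα hi⟩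

/-! ### The update with a new character -/

theorem getElem?_insert (A B : List ℕ) (c i : ℕ) : (A ++ c :: B)[i]? =
    if i < A.length then A[i]? else if i = A.length then some c else B[i - A.length - 1]? := by
  split_ifs with h1 h2
  · exact List.getElem?_append_left h1
  · subst h2; simp
  · rw [List.getElem?_append_right (by omega)]
    obtain ⟨k, hk⟩ : ∃ k, i - A.length = k + 1 := ⟨i - A.length - 1, by omega⟩
    rw [hk]; simp

theorem getElem?_take_insert_drop (X : List ℕ) (c : ℕ) {k : ℕ} (hk : k ≤ X.length) (i : ℕ) :
    (X.take k ++ c :: X.drop k)[i]? =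
      if i < k then X[i]? else if i = k then some c else X[i - 1]? := by
  have hl : (X.take k).length = k := by simp [hk]
  rw [getElem?_insert, hl]
  split_ifs with h1 h2
  · rw [List.getElem?_take_of_lt h1]
  · rfl
  · rw [List.getElem?_drop]; congr 1; omega

theorem Reduces.repPos_eq {D : DBWT} {b : Bool} {A B : List ℕ} {S : Finset ℕ}
    (h : Reduces D b A B S) : repPos D = A.length := by
  rw [repPos, h.expand_eq, List.idxOf_append_of_notMem]
  · simp
  · intro hm
    exact lt_irrefl _ (h.gt _ (List.mem_append_left _ hm))

/-- The summand `1` counts `$` as a character smaller than `c`. It matches the row `0` reserved for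
`$` in `vRow`. -/
theorem Reduces.insPos_eq {D : DBWT} {b : Bool} {A B : List ℕ} {S : Finset ℕ}
    (h : Reduces D b A B S) {c : ℕ} (hc : dollar < c) :
    insPos D c = occLt (A ++ B) c + rank (A ++ B) c A.length + 1 := by
  rw [insPos, h.repPos_eq, h.expand_eq, occLt_insert, rank_insert_of_le _ _ _ _ le_rfl, if_pos hc]
  omega

theorem Reduces.insPos_le {D : DBWT} {b : Bool} {A B : List ℕ} {S : Finset ℕ}
    (h : Reduces D b A B S) {c : ℕ} (hc : dollar < c) : insPos D c ≤ size D := by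
  have h1 := occLt_add_count_le_length (A ++ B) c
  have h2 := rank_le_count (A ++ B) c A.length
  rw [h.insPos_eq hc, h.size_eq]
  omega

theorem Reduces.expand_replaceNode {D : DBWT} {b : Bool} {A B : List ℕ} {S : Finset ℕ}
    (h : Reduces D b A B S) (c : ℕ) : expand (replaceNode D c) = A ++ c :: B := by
  have hA : ∀ x ∈ A, x ≠ dollar := fun x hx => (h.gt x (List.mem_append_left _ hx)).ne'
  have hB : ∀ x ∈ B, x ≠ dollar := fun x hx => (h.gt x (List.mem_append_right _ hx)).ne'
  have key : ∀ l : List ℕ, (∀ x ∈ l, x ≠ dollar) →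
      (l.map fun x => if x = dollar then c else x) = l := by
    intro l hl
    conv_rhs => rw [← List.map_id l]
    exact List.map_congr_left fun x hx => by simp [hl x hx]
  rw [RComp.expand_replaceNode c h.pos, h.expand_eq, List.map_append, List.map_cons, if_pos rfl,
    key A hA, key B hB]
  rw [h.expand_eq, List.count_append, List.count_cons, List.count_eq_zero.2 fun hm => hA _ hm rfl,
    List.count_eq_zero.2 fun hm => hB _ hm rfl]
  simp

theorem Reduces.expand_splitNode {D : DBWT} {b : Bool} {A B : List ℕ} {S : Finset ℕ}
    (h : Reduces D b A B S) (c : ℕ) : expand (splitNode D c) = A ++ c :: B := by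
  rw [splitNode, expand_cutAt, h.expand_replaceNode]

theorem Reduces.mem_bnd_splitNode {D : DBWT} {b : Bool} {A B : List ℕ} {S : Finset ℕ}
    (h : Reduces D b A B S) {c : ℕ} (hc : dollar < c) :
    bnd (splitNode D c) = insert (insPos D c) (bnd D) := by
  rw [splitNode, bnd_cutAt (by rw [size_replaceNode]; exact h.insPos_le hc), bnd_replaceNode]

theorem Reduces.pos_splitNode {D : DBWT} {b : Bool} {A B : List ℕ} {S : Finset ℕ}
    (h : Reduces D b A B S) (c : ℕ) : Pos (splitNode D c) :=
  pos_cutAt (pos_replaceNode h.pos c) _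

theorem Reduces.pos_insertNode {D : DBWT} {b : Bool} {A B : List ℕ} {S : Finset ℕ}
    (h : Reduces D b A B S) (c : ℕ) : Pos (insertNode D c) :=
  pos_insertAt Nat.one_pos (h.pos_splitNode c) _

theorem Reduces.expand_insertNode {D : DBWT} {b : Bool} {A B : List ℕ} {S : Finset ℕ}
    (h : Reduces D b A B S) {c : ℕ} (hc : dollar < c) : expand (insertNode D c) =
      (A ++ c :: B).take (insPos D c) ++ dollar :: (A ++ c :: B).drop (insPos D c) := by
  rw [insertNode, expand_insertAt (h.pos_splitNode c), h.expand_splitNode]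
  · simp
  · rw [h.mem_bnd_splitNode hc]; simp

theorem Reduces.mem_bnd_insertNode {D : DBWT} {b : Bool} {A B : List ℕ} {S : Finset ℕ}
    (h : Reduces D b A B S) {c : ℕ} (hc : dollar < c) (r : ℕ) : r ∈ bnd (insertNode D c) ↔
      (r ≤ insPos D c ∧ (r = insPos D c ∨ r ∈ bnd D)) ∨
      (insPos D c + 1 ≤ r ∧ (r - 1 = insPos D c ∨ r - 1 ∈ bnd D)) := by
  rw [insertNode, bnd_insertAt (h.pos_splitNode c) (by rw [h.mem_bnd_splitNode hc]; simp),
    h.mem_bnd_splitNode hc, Finset.mem_insert, Finset.mem_insert]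

theorem charBefore_insert_eq (A B : List ℕ) (x c : ℕ) :
    charBefore (A ++ x :: B) A.length = some c ↔ A.getLast? = some c := by
  rw [charBefore, List.getLast?_eq_getElem?]
  split_ifs with h
  · simp [List.length_eq_zero_iff.1 h]
  · rw [List.getElem?_append_left (by omega)]

theorem getElem?_insert_length_succ (A B : List ℕ) (x : ℕ) :
    (A ++ x :: B)[A.length + 1]? = B.head? := by
  rw [getElem?_insert, if_neg (by omega), if_neg (by omega), List.head?_eq_getElem?]
  congr 1; omega

theorem Reduces.isFast_iff {D : DBWT} {b : Bool} {A B : List ℕ} {S : Finset ℕ}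
    (h : Reduces D b A B S) (c : ℕ) :
    isFast D c = true ↔ A.getLast? = some c ∨ B.head? = some c := by
  rw [isFast, h.repPos_eq, h.expand_eq, Bool.or_eq_true, beq_iff_eq, beq_iff_eq,
    charBefore_insert_eq, getElem?_insert_length_succ]

/-- The insertion position differs from a neighbouring position of the special character that can
be merged, since LF has no fixed points. -/
theorem Reduces.insPos_ne_left {D : DBWT} {b : Bool} {A B T : List ℕ} {S : Finset ℕ}
    (h : Reduces D b A B S) (hT : IsText T) (hD : bwt T = expand D) {c : ℕ} (hc : dollar < c)
    (hl : A.getLast? = some c) : insPos D c ≠ A.length := by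
  intro he
  obtain ⟨n, hn⟩ : ∃ n, A.length = n + 1 := by
    cases A with
    | nil => simp at hl
    | cons a A => exact ⟨A.length, rfl⟩
  have hlen : n < (expand D).length := by rw [length_expand, h.size_eq]; simp; omega
  have hg : (expand D).getD n 0 = c := by
    rw [h.expand_eq, List.getD_eq_getElem?_getD, List.getElem?_append_left (by omega)]
    rw [List.getLast?_eq_getElem?, hn, Nat.add_sub_cancel] at hl
    simp [hl]
  refine lf_bwt_ne hT (i := n) (by rwa [hD]) (by rw [hD, hg]; exact hc) ?_
  rw [insPos, h.repPos_eq, hn, rank_succ _ _ hlen, if_pos hg] at he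
  rw [hD, lf, hg]
  omega

theorem Reduces.insPos_ne_right {D : DBWT} {b : Bool} {A B T : List ℕ} {S : Finset ℕ}
    (h : Reduces D b A B S) (hT : IsText T) (hD : bwt T = expand D) {c : ℕ} (hc : dollar < c)
    (hr : B.head? = some c) : insPos D c ≠ A.length + 1 := by
  intro he
  have hB : 0 < B.length := by
    cases B with
    | nil => simp at hr
    | cons a B => simp
  have hlen : A.length + 1 < (expand D).length := by rw [length_expand, h.size_eq]; simp; omega
  have hg : (expand D).getD (A.length + 1) 0 = c := by
    rw [h.expand_eq, List.getD_eq_getElem?_getD, getElem?_insert_length_succ, hr]; rfl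
  have hg' : (expand D).getD A.length 0 = dollar := by rw [h.expand_eq, getD_insert_self]
  refine lf_bwt_ne hT (i := A.length + 1) (by rwa [hD]) (by rw [hD, hg]; exact hc) ?_
  rw [insPos, h.repPos_eq] at he
  rw [hD, lf, hg, rank_succ _ _ (by omega), hg', if_neg hc.ne]
  omega

/-- The repetitions after the merging of nodes. -/
theorem mergeNodes_spec {D : DBWT} {c : ℕ} (b : Bool) (hpos : Pos (insertNode D c))
    (hqE : newPos D c ∈ bnd (insertNode D c)) (hqE' : newPos D c + 1 ∈ bnd (insertNode D c))
    (hqs : newPos D c < size (insertNode D c))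
    (hq : (expand (insertNode D c))[newPos D c]? = some c) :
    Pos (mergeNodes D c b) ∧ expand (mergeNodes D c b) = expand (insertNode D c) ∧
    ∀ r, r ∈ bnd (mergeNodes D c b) ↔ r ∈ bnd (insertNode D c) ∧
      ¬ (r = newPos D c ∧ charBefore (expand (insertNode D c)) (newPos D c) = some c) ∧
      ¬ (r = newPos D c + 1 ∧ (expand (insertNode D c))[newPos D c + 1]? = some c ∧
        (charBefore (expand (insertNode D c)) (newPos D c) ≠ some c ∨ b = true)) := by
  have hleft : charBefore (expand (insertNode D c)) (newPos D c) = some c → 0 < newPos D c ∧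
      (expand (insertNode D c))[newPos D c - 1]? = (expand (insertNode D c))[newPos D c]? := by
    intro hl
    rw [charBefore] at hl
    split_ifs at hl with h0
    exact ⟨by omega, by rw [hl, hq]⟩
  have hright : (expand (insertNode D c))[newPos D c + 1]? = some c →
      newPos D c + 1 < size (insertNode D c) ∧
      (expand (insertNode D c))[newPos D c + 1 - 1]? =
        (expand (insertNode D c))[newPos D c + 1]? := by
    intro hr
    refine ⟨?_, by rw [hr, Nat.add_sub_cancel, hq]⟩
    rw [← length_expand]
    exact (List.getElem?_eq_some_iff.1 hr).1
  rw [mergeNodes]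
  simp only [Bool.and_eq_true, beq_iff_eq]
  generalize insertNode D c = E at *
  generalize newPos D c = q at *
  split_ifs with h1 h2 h3
  -- The right end is joined first, so that the boundary `q` keeps its coordinate for the second
  -- join.
  · obtain ⟨⟨hl, hr⟩, hb⟩ := h1
    have e1 := expand_joinAt hpos hqE' (by omega) (hright hr).2
    have b1 := bnd_joinAt hpos hqE' (by omega) (hright hr).1
    have p1 := pos_joinAt hpos (q + 1)
    have hq1 : q ∈ bnd (joinAt E (q + 1)) := by
      rw [b1]; exact Finset.mem_erase.2 ⟨by omega, hqE⟩
    refine ⟨pos_joinAt p1 _, ?_, ?_⟩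
    · rw [expand_joinAt p1 hq1 (hleft hl).1 (by rw [e1]; exact (hleft hl).2), e1]
    · intro r
      rw [bnd_joinAt p1 hq1 (hleft hl).1 (by rw [← length_expand, e1, length_expand]; omega), b1]
      simp only [Finset.mem_erase, hl, hr, hb, and_true, or_true]
      constructor
      · rintro ⟨a, b, c⟩; exact ⟨c, a, b⟩
      · rintro ⟨a, b, c⟩; exact ⟨b, c, a⟩
  · refine ⟨pos_joinAt hpos _, expand_joinAt hpos hqE (hleft h2).1 (hleft h2).2, fun r => ?_⟩
    rw [bnd_joinAt hpos hqE (hleft h2).1 (by omega)]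
    simp only [Finset.mem_erase, h2, and_true, ne_eq, not_true, false_or]
    constructor
    · rintro ⟨a, b⟩; exact ⟨b, a, fun hh => h1 ⟨⟨h2, hh.2.1⟩, hh.2.2⟩⟩
    · rintro ⟨a, b, -⟩; exact ⟨b, a⟩
  · refine ⟨pos_joinAt hpos _, expand_joinAt hpos hqE' (by omega) (hright h3).2, fun r => ?_⟩
    rw [bnd_joinAt hpos hqE' (by omega) (hright h3).1]
    simp only [Finset.mem_erase, h2, h3, and_false, not_false_eq_true, true_and, ne_eq, true_or,
      and_true]
    exact and_comm
  · refine ⟨hpos, rfl, fun r => ?_⟩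
    simp [h2, h3]

/-- The repetitions after the update. -/
theorem Reduces.update_spec {D : DBWT} {b : Bool} {A B T : List ℕ} {S : Finset ℕ}
    (h : Reduces D b A B S) (hT : IsText T) (hD : bwt T = expand D) {c : ℕ} (hc : dollar < c) :
    Pos (update D c b) ∧ expand (update D c b) =
      (A ++ c :: B).take (insPos D c) ++ dollar :: (A ++ c :: B).drop (insPos D c) ∧
    ∀ r, r ∈ bnd (update D c b) ↔ r ∈ bnd (insertNode D c) ∧
      ¬ (r = newPos D c ∧ A.getLast? = some c) ∧
      ¬ (r = newPos D c + 1 ∧ B.head? = some c ∧ (A.getLast? ≠ some c ∨ b = true)) := by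
  have hE := h.expand_insertNode hc
  have hpos := h.pos_insertNode c
  by_cases hf : isFast D c = true
  swap
  · rw [RComp.update, if_neg hf]
    refine ⟨hpos, hE, fun r => ?_⟩
    rw [h.isFast_iff, not_or] at hf
    simp [hf]
  rw [RComp.update, if_pos hf]
  have hnl := h.insPos_ne_left hT hD hc
  have hnr := h.insPos_ne_right hT hD hc
  have hins := h.insPos_le hc
  have hXlen : (A ++ c :: B).length = size D := by rw [h.size_eq]; simp; omega
  have hget := getElem?_take_insert_drop (A ++ c :: B) dollar (hXlen ▸ hins)
  rw [← hE] at hget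
  have hX := getElem?_insert A B c
  have hp : A.length ∈ bnd D := (h.mem_bnd _).2 (Or.inl rfl)
  have hp' : A.length + 1 ∈ bnd D := (h.mem_bnd _).2 (Or.inr (Or.inl rfl))
  have hbE := h.mem_bnd_insertNode hc
  have hnew : newPos D c = if insPos D c ≤ A.length then A.length + 1 else A.length := by
    rw [newPos, h.repPos_eq]
  have hlast : A.getLast? = A[A.length - 1]? := List.getLast?_eq_getElem?
  have hhead : B.head? = B[0]? := List.head?_eq_getElem?
  have hcd : ¬ dollar = c := hc.ne
  have hq : (expand (insertNode D c))[newPos D c]? = some c := by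
    rw [hget, hX, hX, hnew]
    split_ifs <;> first | rfl | omega
  -- The new `$` could hide the left neighbour only if inserted exactly between it and the new `c`,
  -- which `hnl` excludes; `hnr` does the same on the right.
  have hleft : charBefore (expand (insertNode D c)) (newPos D c) = some c ↔
      A.getLast? = some c := by
    rw [charBefore, hget, hX, hX, hnew]
    rcases lt_trichotomy (insPos D c) A.length with h1 | h1 | h1
    · rw [if_pos h1.le, if_neg (by omega), if_neg (by omega), if_neg (by omega), if_pos (by omega),
        hlast, Nat.add_sub_cancel]
    · rw [if_pos h1.le, if_neg (by omega), if_neg (by omega), if_pos (by omega)]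
      simp only [Option.some.injEq, hcd, false_iff]
      exact fun hl => hnl hl h1
    · rw [if_neg (show ¬ insPos D c ≤ A.length by omega)]
      by_cases h2 : A.length = 0
      · simp [List.length_eq_zero_iff.1 h2]
      · rw [if_neg h2, if_pos (by omega), if_pos (by omega), hlast]
  have hright : (expand (insertNode D c))[newPos D c + 1]? = some c ↔ B.head? = some c := by
    rw [hget, hX, hX, hnew]
    by_cases h1 : insPos D c ≤ A.length
    · rw [if_pos h1, if_neg (by omega), if_neg (by omega), if_neg (by omega), if_neg (by omega),
        hhead, show A.length + 1 + 1 - 1 - A.length - 1 = 0 by omega]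
    · rw [if_neg h1]
      by_cases h2 : insPos D c = A.length + 1
      · rw [if_neg (by omega), if_pos h2.symm]
        simp only [Option.some.injEq, hcd, false_iff]
        exact fun hr => hnr hr h2
      · rw [if_pos (by omega), if_neg (by omega), if_neg (by omega),
          hhead, show A.length + 1 - A.length - 1 = 0 by omega]
  have hqE : newPos D c ∈ bnd (insertNode D c) := by
    rw [hbE, hnew]
    split_ifs with h1
    · right; exact ⟨by omega, Or.inr hp⟩
    · left; exact ⟨by omega, Or.inr hp⟩
  have hqE' : newPos D c + 1 ∈ bnd (insertNode D c) := by
    rw [hbE, hnew]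
    split_ifs with h1
    · right; exact ⟨by omega, Or.inr hp'⟩
    · left; exact ⟨by omega, Or.inr hp'⟩
  have hqs : newPos D c < size (insertNode D c) := by
    rw [← length_expand]
    exact (List.getElem?_eq_some_iff.1 hq).1
  obtain ⟨h1, h2, h3⟩ := mergeNodes_spec b hpos hqE hqE' hqs hq
  refine ⟨h1, h2.trans hE, fun r => ?_⟩
  rw [h3]
  simp only [ne_eq, hleft, hright]

/-- The boundaries that remain when the special character of `update D c b` is removed. -/
def nextBnd (D : DBWT) (b : Bool) (A B : List ℕ) (c : ℕ) : Finset ℕ :=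
  (bnd D).filter fun q => ¬ (q = A.length ∧ A.getLast? = some c) ∧
    ¬ (q = A.length + 1 ∧ B.head? = some c ∧ (A.getLast? ≠ some c ∨ b = true))

/-- If the last insertion of `$` cut a repetition, both parts of it still surround `$`. -/
theorem Reduces.getLast_eq_head {D : DBWT} {b : Bool} {A B : List ℕ} {S : Finset ℕ}
    (h : Reduces D b A B S) (hb : b = true) : A.getLast? = B.head? := by
  obtain ⟨h1, h2⟩ := h.run A.length (by simp) (h.flag.1 hb)
  rw [List.getElem?_append_left (by omega), List.getElem?_append_right le_rfl] at h2
  rw [List.getLast?_eq_getElem?, h2, List.head?_eq_getElem?, Nat.sub_self]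

/-- If the place of `$` is in `S`, exactly one end of the node `c` survives: the right end if `c`
joins the left neighbour, the left end if it joins only the right one. If it is not in `S`, both
neighbours equal `c` and both ends vanish. The dependence of merging on the flag thus makes `S` move
without gaining or losing elements. -/
theorem Reduces.nextBnd_eq_image {D : DBWT} {b : Bool} {A B : List ℕ} {S : Finset ℕ}
    (h : Reduces D b A B S) {c : ℕ} (hc : A.getLast? = some c ∨ B.head? = some c) :
    nextBnd D b A B c = S.image (moveBnd A.length
      (decide (B.head? = some c ∧ A.getLast? ≠ some c))) := by
  have hlr := h.getLast_eq_head
  have hflag := h.flag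
  ext q
  have hq := h.mem_bnd q
  simp only [nextBnd, Finset.mem_filter, Finset.mem_image, hq]
  constructor
  · rintro ⟨h1, h2, h3⟩
    by_cases hlt : q < A.length
    · exact ⟨q, by grind, by simp [moveBnd, hlt]⟩
    by_cases hgt : A.length + 1 < q
    · exact ⟨q - 1, by grind, by rw [moveBnd, if_neg (by grind)]; omega⟩
    have hpS : A.length ∈ S := by grind
    refine ⟨A.length, hpS, ?_⟩
    by_cases hqp : q = A.length
    · rw [moveBnd, if_pos (by grind), hqp]
    · rw [moveBnd, if_neg (by grind)]; grind
  · rintro ⟨s, hs, rfl⟩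
    rcases lt_trichotomy s A.length with h1 | h1 | h1
    · rw [moveBnd, if_pos (by grind)]; grind
    · subst h1
      have hb : ¬ b = true := by tauto
      by_cases hl : A.getLast? = some c
      · rw [moveBnd, if_neg (by grind)]; grind
      · rw [moveBnd, if_pos (by grind)]; grind
    · rw [moveBnd, if_neg (by grind)]; grind

/-- Nothing is merged, so both ends of the node `c` remain. One may be the image of an old boundary,
which only helps in counting. -/
theorem Reduces.nextBnd_eq_insert {D : DBWT} {b : Bool} {A B : List ℕ} {S : Finset ℕ}
    (h : Reduces D b A B S) {c : ℕ} (hl : A.getLast? ≠ some c) (hr : B.head? ≠ some c) :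
    nextBnd D b A B c = insert A.length (insert (A.length + 1)
      (S.image (moveBnd A.length false))) := by
  ext q
  have hq := h.mem_bnd q
  simp only [nextBnd, Finset.mem_filter, Finset.mem_insert, Finset.mem_image, hq, hl, hr,
    and_false, false_and, not_false_eq_true, and_true]
  constructor
  · rintro (h1 | h1 | ⟨h1, h2⟩ | ⟨h1, h2⟩)
    · exact Or.inl h1
    · exact Or.inr (Or.inl h1)
    · exact Or.inr (Or.inr ⟨q, h2, by simp [moveBnd, h1]⟩)
    · exact Or.inr (Or.inr ⟨q - 1, h2, by rw [moveBnd, if_neg (by grind)]; omega⟩)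
  · rintro (h1 | h1 | ⟨s, hs, rfl⟩)
    · exact Or.inl h1
    · exact Or.inr (Or.inl h1)
    · rcases lt_trichotomy s A.length with h1 | h1 | h1
      · rw [moveBnd, if_pos (by grind)]; grind
      · rw [moveBnd, if_neg (by grind)]; grind
      · rw [moveBnd, if_neg (by grind)]; grind

/-- Removing boundaries before and after the insertion at position `k`. -/
theorem mem_shift_iff {U : Finset ℕ} {p k : ℕ} {l m n : Prop} (hl : l → k ≠ p)
    (hm : m → k ≠ p + 1) (r : ℕ) :
    ((r ≤ k ∧ (r = k ∨ r ∈ U) ∨ k + 1 ≤ r ∧ (r - 1 = k ∨ r - 1 ∈ U)) ∧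
      ¬ ((r = if k ≤ p then p + 1 else p) ∧ l) ∧
      ¬ (r = (if k ≤ p then p + 1 else p) + 1 ∧ m ∧ n)) ↔
    (r = k ∨ r = k + 1 ∨ r < k ∧ r ∈ U ∧ ¬ (r = p ∧ l) ∧ ¬ (r = p + 1 ∧ m ∧ n) ∨
      k + 1 < r ∧ r - 1 ∈ U ∧ ¬ (r - 1 = p ∧ l) ∧ ¬ (r - 1 = p + 1 ∧ m ∧ n)) := by
  by_cases h : k ≤ p
  · simp only [if_pos h]
    grind
  · simp only [if_neg h]
    grind

/-- The boundaries are those of the string in which `$` has become `c`, before the new `$` is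
inserted. Hence the split at `insPos` affects the flag only, and the cost of an update is that of
the new `c`. -/
theorem Reduces.update {D : DBWT} {b : Bool} {A B T : List ℕ} {S : Finset ℕ}
    (h : Reduces D b A B S) (hT : IsText T) (hD : bwt T = expand D) {c : ℕ} (hc : dollar < c) :
    Reduces (update D c b) (splits D c) ((A ++ c :: B).take (insPos D c))
      ((A ++ c :: B).drop (insPos D c)) (nextBnd D b A B c) := by
  have hspec := h.update_spec hT hD hc
  have hins := h.insPos_le hc
  have hnl := h.insPos_ne_left hT hD hc
  have hnr := h.insPos_ne_right hT hD hc
  have hXlen : (A ++ c :: B).length = size D := by rw [h.size_eq]; simp; omega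
  have hlen : ((A ++ c :: B).take (insPos D c)).length = insPos D c := by simp at hXlen ⊢; omega
  have hle : ∀ s ∈ nextBnd D b A B c, s ≤ (A ++ c :: B).length := by
    intro s hs
    rw [hXlen]
    exact le_size_of_mem_bnd (Finset.mem_filter.1 hs).1
  have hinsmem : insPos D c ∈ nextBnd D b A B c ↔ insPos D c ∈ bnd D := by
    rw [nextBnd, Finset.mem_filter]; tauto
  refine ⟨hspec.1, hspec.2.1, ?_, ?_, ?_, ?_, ?_, ?_⟩
  · rw [List.take_append_drop]
    intro a ha
    rcases List.mem_append.1 ha with ha | ha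
    · exact h.gt a (List.mem_append_left _ ha)
    · rcases List.mem_cons.1 ha with rfl | ha
      · exact hc
      · exact h.gt a (List.mem_append_right _ ha)
  · rw [List.take_append_drop]; exact hle
  · rw [hlen, splits_iff hins, hinsmem]
  · rw [List.take_append_drop]
    intro s hs hs'
    by_cases hm : s ∈ bnd D
    · rw [nextBnd, Finset.mem_filter, not_and, not_and_or, not_not, not_not] at hs'
      rcases hs' hm with ⟨rfl, hl⟩ | ⟨rfl, hr, -⟩
      · have h0 : 0 < A.length := by
          cases A with
          | nil => simp at hl
          | cons a A => simp
        refine ⟨h0, ?_⟩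
        rw [getElem?_insert, getElem?_insert, if_pos (by omega), if_neg (by omega), if_pos rfl,
          ← List.getLast?_eq_getElem?, hl]
      · refine ⟨by omega, ?_⟩
        rw [getElem?_insert_length_succ, hr]
        simp
    · have h1 : s ≠ size D := fun he => hm (he ▸ size_mem_bnd D)
      have h2 := getElem?_expand_pred_eq (D := replaceNode D c) (q := s)
        (by rw [size_replaceNode]; omega) (by rwa [bnd_replaceNode])
      rwa [h.expand_replaceNode] at h2
  · intro r
    rw [hspec.2.2, h.mem_bnd_insertNode hc, hlen, nextBnd, Finset.mem_filter, Finset.mem_filter,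
      newPos, h.repPos_eq]
    exact mem_shift_iff hnl hnr r
  · rw [List.take_append_drop, hlen, h.insPos_eq hc]
    have hb := h.bound
    -- With an equal neighbour `S` only moves, and neither the potential nor the number of runs
    -- decreases. Otherwise two boundaries cost `3 + 8` each, which the increase of `22 * runs`
    -- covers.
    by_cases hlr : A.getLast? = some c ∨ B.head? = some c
    · rw [h.nextBnd_eq_image hlr]
      have h1 := totalPotential_le_image (A := A) (B := B) (c := c)
        (right := decide (B.head? = some c ∧ A.getLast? ≠ some c)) h.le
        (fun hh => (of_decide_eq_true hh).1)
      have h2 := Finset.card_image_le (s := S) (f := moveBnd A.length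
        (decide (B.head? = some c ∧ A.getLast? ≠ some c)))
      have h3 := runs_le_insert A B c
      omega
    · rw [not_or] at hlr
      rw [h.nextBnd_eq_insert hlr.1 hlr.2] at hle ⊢
      have h1 := totalPotential_le_image (A := A) (B := B) (c := c) (right := false) h.le
        (fun hh => by simp at hh)
      have h2 := Finset.card_image_le (s := S) (f := moveBnd A.length false)
      have h3 := runs_lt_insert A B c hlr.1 hlr.2
      have h4 := Finset.card_insert_le (A.length + 1) (S.image (moveBnd A.length false))
      have h5 := Finset.card_insert_le A.length
        (insert (A.length + 1) (S.image (moveBnd A.length false)))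
      have h6 := totalPotential_le_insert (X := A ++ c :: B) (e := A.length + 1)
        (p := occLt (A ++ B) c + rank (A ++ B) c A.length + 1)
        (S := S.image (moveBnd A.length false))
        (fun s hs => hle s (by simp only [Finset.mem_insert]; exact Or.inr (Or.inr hs)))
        (hle _ (by simp))
      have h7 := totalPotential_le_insert (X := A ++ c :: B) (e := A.length)
        (p := occLt (A ++ B) c + rank (A ++ B) c A.length + 1)
        (S := insert (A.length + 1) (S.image (moveBnd A.length false)))
        (fun s hs => hle s (by rw [Finset.mem_insert]; exact Or.inr hs)) (hle _ (by simp))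
      omega

/-! ### Runs of the algorithm -/

theorem IsText.cons {S : List ℕ} (h : IsText S) {c : ℕ} (hc : dollar < c) : IsText (c :: S) := by
  obtain ⟨S, rfl, h⟩ := h
  refine ⟨c :: S, rfl, fun x hx => ?_⟩
  rcases List.mem_cons.1 hx with rfl | hx
  · exact hc
  · exact h x hx

theorem IsText.drop {T : List ℕ} (h : IsText T) {i : ℕ} (hi : i < T.length) :
    IsText (T.drop i) := by
  obtain ⟨S, rfl, h⟩ := h
  simp only [List.length_append, List.length_singleton] at hi
  exact ⟨S.drop i, by rw [List.drop_append_of_le_length (by omega)],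
    fun c hc => h c (List.mem_of_mem_drop hc)⟩

theorem IsText.dollar_mem {T : List ℕ} (h : IsText T) : dollar ∈ T := by
  obtain ⟨S, rfl, -⟩ := h; simp

theorem IsText.ne_nil {T : List ℕ} (h : IsText T) : T ≠ [] := by
  obtain ⟨S, rfl, -⟩ := h; simp

theorem IsText.dollar_lt_nextChar {T : List ℕ} (h : IsText T) {δ : ℕ} (h1 : 1 ≤ δ)
    (hδ : δ < T.length) : dollar < nextChar T δ := by
  obtain ⟨m, hm, -, hgt⟩ := h.exists_length
  exact hgt _ (by omega)

theorem drop_eq_nextChar_cons {T : List ℕ} {δ : ℕ} (hδ : δ < T.length) :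
    T.drop (T.length - (δ + 1)) = nextChar T δ :: T.drop (T.length - δ) := by
  rw [List.drop_eq_getElem_cons (by omega), nextChar, List.getD_eq_getElem _ _ (by omega)]
  congr 2
  omega

theorem nextChar_mem {T : List ℕ} {δ : ℕ} (hδ : δ < T.length) : nextChar T δ ∈ T :=
  getD_mem (by omega)

theorem mem_of_mem_bwt {S : List ℕ} {a : ℕ} (h : a ∈ bwt S) : a ∈ S := by
  rw [bwt_eq_map, List.mem_map] at h
  obtain ⟨i, hi, rfl⟩ := h
  rw [mem_suffixArray] at hi
  rw [prevChar]
  split_ifs <;> exact getD_mem (by omega)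

/-- Removing the special character from the BWT, the number of runs does not decrease when the text
is extended. -/
theorem exists_bwt_append {S : List ℕ} (hS : IsText S) {A B : List ℕ}
    (hL : bwt S = A ++ dollar :: B) (hAB : ∀ a ∈ A ++ B, dollar < a) (P : List ℕ)
    (hP : ∀ c ∈ P, dollar < c) :
    ∃ A' B', bwt (P ++ S) = A' ++ dollar :: B' ∧ (∀ a ∈ A' ++ B', dollar < a) ∧
      IsText (P ++ S) ∧ runs (A ++ B) ≤ runs (A' ++ B') := by
  induction P with
  | nil => exact ⟨A, B, hL, hAB, hS, le_rfl⟩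
  | cons c P ih =>
    obtain ⟨A', B', hL', hAB', hS', hr⟩ := ih fun x hx => hP x (List.mem_cons_of_mem _ hx)
    have hc := hP c List.mem_cons_self
    refine ⟨_, _, bwt_cons hS' hc hL' hAB', ?_, hS'.cons hc, ?_⟩
    · rw [List.take_append_drop]
      intro a ha
      rcases List.mem_append.1 ha with ha | ha
      · exact hAB' a (List.mem_append_left _ ha)
      · rcases List.mem_cons.1 ha with rfl | ha
        · exact hc
        · exact hAB' a (List.mem_append_right _ ha)
    · rw [List.take_append_drop]
      exact hr.trans (runs_le_insert A' B' c)

theorem runs_le_numRuns {T : List ℕ} (hT : IsText T) {i : ℕ} (hi : i < T.length) {A B : List ℕ}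
    (hL : bwt (T.drop i) = A ++ dollar :: B) (hAB : ∀ a ∈ A ++ B, dollar < a) :
    runs (A ++ B) ≤ numRuns T := by
  have hP : ∀ c ∈ T.take i, dollar < c := by
    obtain ⟨S, rfl, h⟩ := hT
    simp only [List.length_append, List.length_singleton] at hi
    rw [List.take_append_of_le_length (by omega)]
    exact fun c hc => h c (List.mem_of_mem_take hc)
  obtain ⟨A', B', hL', -, -, hr⟩ := exists_bwt_append (hT.drop hi) hL hAB _ hP
  rw [List.take_append_drop] at hL'
  rw [numRuns_eq_runs, hL']
  exact hr.trans (runs_le_insert A' B' dollar)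

theorem numRuns_pos {T : List ℕ} (hT : IsText T) : 0 < numRuns T := by
  rw [numRuns_eq_runs]
  refine runs_pos fun h => hT.ne_nil ?_
  have := length_bwt T
  rw [h] at this
  exact List.eq_nil_of_length_eq_zero this.symm

/-- The additive `3` of the invariant pays for the single boundary `0` of the empty string. -/
theorem reduces_init : Reduces [(dollar, 1)] false [] [] {0} := by
  refine ⟨by simp [Pos], by simp [expand], by simp, by simp, by simp, ?_, ?_, by simp⟩
  · intro s hs hs'
    simp at hs hs'
    omega
  · intro q
    simp only [bnd]
    simp
    omega

theorem Run.exists_reduces {α : ℕ} {T : List ℕ} (hα : 16 ≤ α) (hT : IsText T) {δ : ℕ} {D : DBWT}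
    {b : Bool} (h : Run α T δ D b) : 1 ≤ δ ∧ δ ≤ T.length ∧
      bwt (T.drop (T.length - δ)) = expand D ∧ ∃ A B S, Reduces D b A B S := by
  induction h with
  | init =>
    refine ⟨le_rfl, List.length_pos_iff.2 hT.ne_nil, ?_, _, _, _, reduces_init⟩
    obtain ⟨S, rfl, -⟩ := hT
    simp [bwt_dollar, expand]
  | step δ D D' b _ hδ hb _ ih =>
    obtain ⟨h1, h2, hD, A, B, S, hR⟩ := ih
    have hc := hT.dollar_lt_nextChar h1 hδ
    have hS := hT.drop (i := T.length - δ) (by omega)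
    obtain ⟨S', hR'⟩ := (hR.update hS hD hc).balance hα hb
    refine ⟨by omega, hδ, ?_, _, _, S', hR'⟩
    rw [drop_eq_nextChar_cons hδ, bwt_cons hS hc (hD.trans hR.expand_eq) hR.gt, hR'.expand_eq,
      insPos, hR.repPos_eq, hD]

/-- The additive `4` is absorbed because `numRuns T` is positive, whence `26 = 22 + 4`. -/
theorem Run.length_le {α : ℕ} {T : List ℕ} (hα : 16 ≤ α) (hT : IsText T) {δ : ℕ} {D : DBWT}
    {b : Bool} (h : Run α T δ D b) : D.length ≤ 26 * numRuns T := by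
  obtain ⟨h1, h2, hD, A, B, S, hR⟩ := h.exists_reduces hα hT
  have h3 := runs_le_numRuns hT (i := T.length - δ) (by omega) (hD.trans hR.expand_eq) hR.gt
  have h4 := hR.length_le
  have h5 := numRuns_pos hT
  omega

/-! ### The states visited during the execution -/

theorem length_compress_le (D : DBWT) : (compress D).length ≤ D.length := by
  induction D with
  | nil => simp [compress]
  | cons x D ih =>
    obtain ⟨a, l⟩ := x
    rw [compress]
    split
    · rename_i h
      rw [h] at ih
      simp only [List.length_cons] at ih ⊢
      split_ifs <;> simp <;> omega
    · simp

theorem size_compress (D : DBWT) : size (compress D) = size D := by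
  induction D with
  | nil => simp [compress]
  | cons x D ih =>
    obtain ⟨a, l⟩ := x
    rw [compress]
    split
    · rename_i h
      rw [h] at ih
      rw [size_cons, ← ih]
      split_ifs <;> simp only [size_cons]
      omega
    · rename_i h
      rw [h] at ih
      rw [size_cons, size_cons, ← ih]

theorem fst_mem_of_mem_compress {D : DBWT} {x : ℕ × ℕ} (h : x ∈ compress D) :
    x.1 ∈ D.map Prod.fst := by
  induction D generalizing x with
  | nil => simp [compress] at h
  | cons y D ih =>
    obtain ⟨a, l⟩ := y
    rw [compress] at h
    split at h
    · rename_i b k E he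
      rw [he] at ih
      split_ifs at h with hab
      · rcases List.mem_cons.1 h with rfl | h
        · simp
        · simpa using Or.inr (ih (List.mem_cons_of_mem _ h))
      · rcases List.mem_cons.1 h with rfl | h
        · simp
        · simpa using Or.inr (ih h)
    · rw [List.mem_singleton] at h
      simp [h]

theorem snd_le_size {D : DBWT} {x : ℕ × ℕ} (h : x ∈ D) : x.2 ≤ size D :=
  List.single_le_sum (by simp) _ (List.mem_map_of_mem h)

theorem fst_mem_expand {D : DBWT} (hD : Pos D) {x : ℕ × ℕ} (h : x ∈ D) : x.1 ∈ expand D := by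
  rw [expand, List.mem_flatMap]
  exact ⟨x, h, by simpa using (hD x h).ne'⟩

/-- The properties of a visited state on which the working space depends. -/
structure Bounded (T : List ℕ) (D : DBWT) : Prop where
  pos : Pos D
  size_le : size D ≤ T.length
  mem : ∀ x ∈ D, x.1 ∈ T
  length_le : D.length ≤ 28 * numRuns T

/-- Between two runs of balancing, the split and the insertion add at most one node each, so `26`
becomes `28`. -/
theorem Visits.bounded {α : ℕ} {T : List ℕ} (hα : 16 ≤ α) (hT : IsText T) {D out : DBWT}
    (h : Visits α T D out) : Bounded T D ∧ (out = [] ∨ out = D ∨ out = D ++ compress D) := by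
  have hr := numRuns_pos hT
  have hmem : ∀ {δ : ℕ} {D : DBWT}, bwt (T.drop (T.length - δ)) = expand D →
      ∀ a ∈ expand D, a ∈ T := fun hD a ha =>
    List.mem_of_mem_drop (mem_of_mem_bwt (hD ▸ ha))
  have hsize : ∀ {δ : ℕ} {D : DBWT}, δ ≤ T.length → bwt (T.drop (T.length - δ)) = expand D →
      size D = δ := by
    intro δ D hδ hD
    rw [← length_expand, ← hD, length_bwt, List.length_drop]
    omega
  have hins : ∀ {δ : ℕ} {D : DBWT} {A B : List ℕ}, δ < T.length →
      bwt (T.drop (T.length - δ)) = expand D → expand D = A ++ dollar :: B →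
      ∀ a ∈ A ++ nextChar T δ :: B, a ∈ T := by
    intro δ D A B hδ hD he a ha
    have hm := hmem hD
    rw [he] at hm
    simp only [List.mem_append, List.mem_cons] at ha hm
    rcases ha with ha | rfl | ha
    · exact hm a (Or.inl ha)
    · exact nextChar_mem hδ
    · exact hm a (Or.inr (Or.inr ha))
  have hrun : ∀ {δ : ℕ} {D : DBWT} {b : Bool}, Run α T δ D b → Bounded T D := by
    intro δ D b h
    have h6 := h.length_le hα hT
    obtain ⟨h1, h2, hD, A, B, S, hR⟩ := h.exists_reduces hα hT
    exact ⟨hR.pos, (hsize h2 hD).trans_le h2, fun x hx => hmem hD _ (fst_mem_expand hR.pos hx),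
      by omega⟩
  cases h with
  | start δ _ b h => exact ⟨hrun h, Or.inl rfl⟩
  | replaced δ D b h hδ =>
    have h6 := h.length_le hα hT
    obtain ⟨h1, h2, hD, A, B, S, hR⟩ := h.exists_reduces hα hT
    have hp := pos_replaceNode hR.pos (nextChar T δ)
    refine ⟨⟨hp, ?_, fun x hx => ?_, ?_⟩, Or.inl rfl⟩
    · rw [size_replaceNode, hsize h2 hD]; exact h2
    · refine hins hδ hD hR.expand_eq _ ?_
      rw [← hR.expand_replaceNode]
      exact fst_mem_expand hp hx
    · rw [length_replaceNode]; omega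
  | split δ D b h hδ =>
    have h6 := h.length_le hα hT
    obtain ⟨h1, h2, hD, A, B, S, hR⟩ := h.exists_reduces hα hT
    have hp := hR.pos_splitNode (nextChar T δ)
    refine ⟨⟨hp, ?_, fun x hx => ?_, ?_⟩, Or.inl rfl⟩
    · rw [splitNode, ← length_expand, expand_cutAt, length_expand, size_replaceNode, hsize h2 hD]
      exact h2
    · refine hins hδ hD hR.expand_eq _ ?_
      rw [← hR.expand_splitNode]
      exact fst_mem_expand hp hx
    · have := length_cutAt_le (replaceNode D (nextChar T δ)) (insPos D (nextChar T δ))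
      rw [length_replaceNode, ← splitNode] at this
      omega
  | inserted δ D b h hδ =>
    have h6 := h.length_le hα hT
    obtain ⟨h1, h2, hD, A, B, S, hR⟩ := h.exists_reduces hα hT
    have hc := hT.dollar_lt_nextChar h1 hδ
    have hp := hR.pos_insertNode (nextChar T δ)
    refine ⟨⟨hp, ?_, fun x hx => ?_, ?_⟩, Or.inl rfl⟩
    · have hl : (A ++ nextChar T δ :: B).length = δ := by
        rw [← hsize h2 hD, hR.size_eq]; simp; omega
      rw [← length_expand, hR.expand_insertNode hc, List.length_append, List.length_cons,
        List.length_take, List.length_drop, hl]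
      omega
    · have hx := fst_mem_expand hp hx
      rw [hR.expand_insertNode hc, List.mem_append, List.mem_cons] at hx
      rcases hx with hx | hx | hx
      · exact hins hδ hD hR.expand_eq _ (List.mem_of_mem_take hx)
      · rw [hx]; exact hT.dollar_mem
      · exact hins hδ hD hR.expand_eq _ (List.mem_of_mem_drop hx)
    · have := length_cutAt_le (replaceNode D (nextChar T δ)) (insPos D (nextChar T δ))
      rw [length_replaceNode, ← splitNode] at this
      rw [insertNode, length_insertAt]
      omega
  | balancing δ D₀ D' b h hδ hb =>
    obtain ⟨h1, h2, hD, A, B, S, hR⟩ := h.exists_reduces hα hT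
    have hc := hT.dollar_lt_nextChar h1 hδ
    have hS := hT.drop (i := T.length - δ) (by omega)
    -- Each balancing step preserves the invariant, so unfinished balancing needs no separate bound.
    obtain ⟨S', hR'⟩ := (hR.update hS hD hc).balance hα hb
    have hD' : bwt (T.drop (T.length - (δ + 1))) = expand D := by
      rw [drop_eq_nextChar_cons hδ, bwt_cons hS hc (hD.trans hR.expand_eq) hR.gt,
        hD, ← hR.repPos_eq, ← insPos, ← hR'.expand_eq]
    have h3 := runs_le_numRuns hT (i := T.length - (δ + 1)) (by omega)
      (hD'.trans hR'.expand_eq) hR'.gt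
    have h4 := hR'.length_le
    exact ⟨⟨hR'.pos, (hsize hδ hD').trans_le hδ,
      fun x hx => hmem hD' _ (fst_mem_expand hR'.pos hx), by omega⟩, Or.inl rfl⟩
  | recovered _ b h => exact ⟨hrun h, Or.inr (Or.inl rfl)⟩
  | converted _ b h => exact ⟨hrun h, Or.inr (Or.inr rfl)⟩

/-! ### Working space -/

theorem mem_vOrder {D : DBWT} {i : ℕ} : i ∈ vOrder D ↔ i < D.length := by
  simp [vOrder]

theorem length_vOrder (D : DBWT) : (vOrder D).length = D.length := by
  simp [vOrder]

theorem getD_vOrder_le (D : DBWT) (j : ℕ) : (vOrder D).getD j D.length ≤ D.length := by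
  rw [List.getD_eq_getElem?_getD]
  cases h : (vOrder D)[j]? with
  | none => simp
  | some a => exact (mem_vOrder.1 (List.mem_of_getElem? h)).le

theorem length_graphWords (D : DBWT) : (graphWords D).length = 14 * D.length := by
  have h1 : ∀ l : List ℕ, (l.flatMap (uRecord D)).length = 7 * l.length := by
    intro l
    induction l with
    | nil => rfl
    | cons a l ih => simp [ih, uRecord]; omega
  have h2 : ∀ l : List ℕ, (l.flatMap (vRecord D)).length = 7 * l.length := by
    intro l
    induction l with
    | nil => rfl
    | cons a l ih => simp [ih, vRecord]; omega
  rw [graphWords, List.length_append, h1, h2, List.length_range]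
  omega

theorem char_lt {D : DBWT} {V : ℕ} (hV : 0 < V) (h : ∀ x ∈ D, x.1 < V) (i : ℕ) : char D i < V := by
  rw [char, List.getD_eq_getElem?_getD]
  cases he : D[i]? with
  | none => simpa using hV
  | some a => exact h a (List.mem_of_getElem? he)

theorem len_le_size (D : DBWT) (i : ℕ) : len D i ≤ size D := by
  rw [len, List.getD_eq_getElem?_getD]
  cases he : D[i]? with
  | none => simp
  | some a => exact snd_le_size (List.mem_of_getElem? he)

theorem findIdx_range_le (k : ℕ) (P : ℕ → Bool) : (List.range k).findIdx P ≤ k := by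
  simpa using List.findIdx_le_length (xs := List.range k) (p := P)

theorem lt_of_mem_graphWords {D : DBWT} {V : ℕ} (hD : Pos D) (hs : size D < V)
    (h : ∀ x ∈ D, x.1 < V) : ∀ x ∈ graphWords D, x < V := by
  have hk := length_le_size hD
  intro x hx
  rw [graphWords, List.mem_append, List.mem_flatMap, List.mem_flatMap] at hx
  rcases hx with ⟨i, hi, hx⟩ | ⟨i, hi, hx⟩
  · rw [List.mem_range] at hi
    have h1 : edgeL D i ≤ D.length := findIdx_range_le _ _
    have h2 := uStart_le_size D i
    have h3 := char_lt (by omega) h i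
    have h4 := len_le_size D i
    simp only [uRecord, List.mem_cons, List.not_mem_nil, or_false] at hx
    rcases hx with rfl | rfl | rfl | rfl | rfl | rfl | rfl
    · split_ifs <;> omega
    all_goals omega
  · rw [List.mem_range] at hi
    have h1 : edgeF D i ≤ D.length := findIdx_range_le _ _
    have h2 : vStart D i ≤ size D := by rw [← length_expand]; exact lf_le_length _ _
    have h3 := char_lt (by omega) h i
    have h4 := len_le_size D i
    simp only [vRecord, List.mem_cons, List.not_mem_nil, or_false] at hx
    rcases hx with rfl | rfl | rfl | rfl | rfl | rfl | rfl
    · split_ifs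
      · omega
      · have := getD_vOrder_le D ((vOrder D).idxOf i - 1)
        omega
    · have := getD_vOrder_le D ((vOrder D).idxOf i + 1)
      omega
    all_goals omega

/-! ### Size of the order-maintenance structure -/

theorem OrderList.Valid.length_le {w k : ℕ} {o : OrderList} (h : o.Valid w k) :
    o.length ≤ k ∧ (o.map fun g => g.2.length).sum = k := by
  obtain ⟨h1, -, -, h2⟩ := h
  have h3 : (o.map fun g => g.2.length).sum = k := by
    have := congrArg List.length h1
    simpa [List.length_flatMap] using this
  refine ⟨?_, h3⟩
  rw [← h3]
  have : ∀ l : OrderList, (∀ g ∈ l, g.2 ≠ []) → l.length ≤ (l.map fun g => g.2.length).sum := by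
    intro l hl
    induction l with
    | nil => simp
    | cons g l ih =>
      have h4 := ih fun x hx => hl x (List.mem_cons_of_mem _ hx)
      have h5 := List.length_pos_iff.2 (hl g List.mem_cons_self)
      simp only [List.length_cons, List.map_cons, List.sum_cons]
      omega
  exact this o fun g hg => (h2 g hg).1

/-- Groups are non-empty, so there are at most `k` of them; `8 = 3 + 5` counts the words of a group
and of an element. -/
theorem OrderList.Valid.length_words_le {w k : ℕ} {o : OrderList} (h : o.Valid w k) :
    (o.words k).length ≤ 8 * k := by
  obtain ⟨h1, h2⟩ := h.length_le
  have key : ∀ (l : OrderList) (s N : ℕ),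
      ((l.zipIdx s).flatMap fun x : (ℕ × List (ℕ × ℕ)) × ℕ =>
        [x.1.1, if x.2 = 0 then N else x.2 - 1, x.2 + 1] ++
          x.1.2.flatMap fun e => [e.1, e.2, x.2, if e.1 = 0 then k else e.1 - 1, e.1 + 1]).length =
      3 * l.length + 5 * (l.map fun g => g.2.length).sum := by
    intro l s N
    induction l generalizing s with
    | nil => simp
    | cons g l ih =>
      rw [List.zipIdx_cons, List.flatMap_cons, List.length_append, ih]
      simp [List.length_flatMap]
      omega
  have h3 := key o 0 o.length
  have h4 : (o.words k).length = _ := h3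
  omega

theorem OrderList.Valid.lt_of_mem_words {w k : ℕ} {o : OrderList} (h : o.Valid w k)
    (hk : k < 2 ^ w) : ∀ x ∈ o.words k, x < 2 ^ w := by
  obtain ⟨h1, -⟩ := h.length_le
  obtain ⟨h2, -, h3, h4⟩ := h
  intro x hx
  rw [OrderList.words, List.mem_flatMap] at hx
  obtain ⟨⟨g, j⟩, hg, hx⟩ := hx
  obtain ⟨hj, hgj⟩ := List.mem_zipIdx' hg
  have hgo : g ∈ o := hgj ▸ List.getElem_mem _
  simp only [List.mem_append, List.mem_cons, List.not_mem_nil, or_false, List.mem_flatMap] at hx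
  rcases hx with (rfl | rfl | rfl) | ⟨e, he, hx⟩
  · exact h3 g hgo
  · split_ifs <;> omega
  · omega
  · have hek : e.1 < k := by
      rw [← List.mem_range, ← h2, List.mem_flatMap]
      exact ⟨g, hgo, List.mem_map_of_mem he⟩
    rcases hx with rfl | rfl | rfl | rfl | rfl
    · omega
    · exact (h4 g hgo).2.2 e he
    · omega
    · split_ifs <;> omega
    · omega

/-! ### Size of the B-tree and its addresses -/

theorem mem_interleave {cs : List (List ℕ)} {ks : List ℕ} {x : ℕ} :
    x ∈ interleave cs ks ↔ (∃ c ∈ cs, x ∈ c) ∨ x ∈ ks := by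
  induction cs generalizing ks with
  | nil => simp [interleave]
  | cons c cs ih =>
    cases ks with
    | nil => simp [interleave, ih]
    | cons k ks =>
      simp only [interleave, List.mem_append, List.mem_cons, ih, exists_eq_or_imp]
      generalize (∃ c ∈ cs, x ∈ c) = P
      tauto

theorem length_interleave (cs : List (List ℕ)) (ks : List ℕ) :
    (interleave cs ks).length = (cs.map List.length).sum + ks.length := by
  induction cs generalizing ks with
  | nil => simp [interleave]
  | cons c cs ih =>
    cases ks with
    | nil => simp [interleave, ih]
    | cons k ks => simp [interleave, ih]; omega

theorem BTree.numNodes_pos (h : ℕ) (t : BTree h) : 0 < BTree.numNodes h t := by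
  cases h with
  | zero => simp [BTree.numNodes]
  | succ h => obtain ⟨ks, cs⟩ := t; simp [BTree.numNodes]

/-- For `m ≥ 3` every node except possibly a root that is a leaf holds at least one key, and
distinct nodes account for distinct entries of the inorder list. -/
theorem BTree.Valid.numNodes_le {m : ℕ} (hm : 3 ≤ m) {root : Bool} {h : ℕ} {t : BTree h}
    (ht : BTree.Valid m root h t) :
    BTree.numNodes h t ≤ (BTree.inorder h t).length + (if root then 1 else 0) := by
  induction h generalizing root with
  | zero =>
    rw [BTree.Valid] at ht
    rw [BTree.numNodes, BTree.inorder]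
    cases root
    · have := ht.2 rfl
      simp only [Bool.false_eq_true, if_false]
      omega
    · simp
  | succ h ih =>
    obtain ⟨ks, cs⟩ := t
    rw [BTree.Valid] at ht
    obtain ⟨-, -, h1, -, h2⟩ := ht
    rw [BTree.numNodes, BTree.inorder, length_interleave, List.map_map]
    have h3 : (cs.map (BTree.numNodes h)).sum ≤
        (cs.map (List.length ∘ BTree.inorder h)).sum := by
      refine List.sum_le_sum fun t ht => ?_
      simpa using ih (h2 t ht)
    omega

theorem length_childAddrs (h a : ℕ) (cs : List (BTree h)) :
    (childAddrs h a cs).length = cs.length := by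
  induction cs generalizing a with
  | nil => rfl
  | cons t ts ih => simp [childAddrs, ih]

/-- The padding length suffices because `1 + 3 * (m - 1) + m ≤ 4 * m`. -/
theorem length_btreeBlock {m : ℕ} {D : DBWT} {ks addrs : List ℕ} (hks : ks.length + 1 ≤ m)
    (ha : addrs.length ≤ m) : (btreeBlock m D ks addrs).length = 4 * m := by
  have h1 : (ks.flatMap fun i => [i, i, char D i]).length = 3 * ks.length := by
    induction ks with
    | nil => rfl
    | cons k ks ih =>
      rw [List.flatMap_cons, List.length_append, ih (by simp at hks; omega)]
      simp; omega
  rw [btreeBlock, List.length_rightpad, List.length_append, List.length_cons, h1]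
  omega

theorem BTree.Valid.length_words {m : ℕ} {D : DBWT} {root : Bool} {h : ℕ} {t : BTree h}
    (ht : BTree.Valid m root h t) (a : ℕ) :
    (BTree.words m D h a t).length = 4 * m * BTree.numNodes h t := by
  induction h generalizing root a with
  | zero =>
    rw [BTree.Valid] at ht
    rw [BTree.words, length_btreeBlock ht.1 (by simp), BTree.numNodes, mul_one]
  | succ h ih =>
    obtain ⟨ks, cs⟩ := t
    rw [BTree.Valid] at ht
    obtain ⟨h0, -, -, h1, h2⟩ := ht
    have key : ∀ (cs : List (BTree h)) (a : ℕ), (∀ t ∈ cs, BTree.Valid m false h t) →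
        ((cs.zip (childAddrs h a cs)).flatMap
          fun x : BTree h × ℕ => BTree.words m D h x.2 x.1).length =
        4 * m * (cs.map (BTree.numNodes h)).sum := by
      intro cs a hcs
      induction cs generalizing a with
      | nil => simp
      | cons t ts ihts =>
        rw [childAddrs, List.zip_cons_cons, List.flatMap_cons, List.length_append,
          ihts _ fun t ht => hcs t (List.mem_cons_of_mem _ ht), ih (hcs t List.mem_cons_self),
          List.map_cons, List.sum_cons, mul_add]
    rw [BTree.words, List.length_append,
      length_btreeBlock h0 (by rw [length_childAddrs]; omega), BTree.numNodes, mul_add, mul_one]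
    congr 1
    exact key cs (a + 1) h2

/-- Subtrees occupy consecutive ranges of blocks, so each ends within the range of its parent. -/
theorem childAddrs_bound {h : ℕ} {cs : List (BTree h)} {a : ℕ} {t : BTree h} {a' : ℕ}
    (ht : (t, a') ∈ cs.zip (childAddrs h a cs)) :
    t ∈ cs ∧ a' + BTree.numNodes h t ≤ a + (cs.map (BTree.numNodes h)).sum := by
  induction cs generalizing a with
  | nil => simp at ht
  | cons s cs ih =>
    rw [childAddrs, List.zip_cons_cons, List.mem_cons] at ht
    rcases ht with ht | ht
    · rw [Prod.mk.injEq] at ht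
      obtain ⟨rfl, rfl⟩ := ht
      exact ⟨List.mem_cons_self, by simp⟩
    · obtain ⟨h1, h2⟩ := ih ht
      refine ⟨List.mem_cons_of_mem _ h1, ?_⟩
      rw [List.map_cons, List.sum_cons]
      omega

theorem lt_of_mem_childAddrs {h : ℕ} {cs : List (BTree h)} {a x : ℕ}
    (hx : x ∈ childAddrs h a cs) : x < a + (cs.map (BTree.numNodes h)).sum := by
  induction cs generalizing a with
  | nil => simp [childAddrs] at hx
  | cons s cs ih =>
    rw [childAddrs, List.mem_cons] at hx
    have := BTree.numNodes_pos h s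
    rw [List.map_cons, List.sum_cons]
    rcases hx with rfl | hx
    · omega
    · have := ih hx
      omega

theorem lt_of_mem_btreeBlock {m V : ℕ} {D : DBWT} {ks addrs : List ℕ} (hV : 0 < V)
    (hks : ks.length < V) (hk : ∀ i ∈ ks, i < V) (hc : ∀ i, char D i < V)
    (ha : ∀ x ∈ addrs, x < V) : ∀ x ∈ btreeBlock m D ks addrs, x < V := by
  intro x hx
  simp only [btreeBlock, List.rightpad, List.mem_append, List.mem_cons, List.mem_flatMap,
    List.mem_replicate, List.not_mem_nil, or_false] at hx
  rcases hx with ((rfl | ⟨i, hi, rfl | rfl | rfl⟩) | hx) | ⟨-, rfl⟩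
  · exact hks
  · exact hk _ hi
  · exact hk _ hi
  · exact hc _
  · exact ha x hx
  · exact hV

theorem BTree.lt_of_mem_words {m V : ℕ} {D : DBWT} (hV : 0 < V) (hc : ∀ i, char D i < V)
    {h : ℕ} {t : BTree h} {a : ℕ} (hk : ∀ i ∈ BTree.inorder h t, i < V)
    (hlen : (BTree.inorder h t).length < V) (ha : a + BTree.numNodes h t ≤ V) :
    ∀ x ∈ BTree.words m D h a t, x < V := by
  induction h generalizing a with
  | zero =>
    rw [BTree.inorder] at hk hlen
    exact lt_of_mem_btreeBlock hV hlen hk hc (by simp)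
  | succ h ih =>
    obtain ⟨ks, cs⟩ := t
    rw [BTree.inorder] at hk hlen
    rw [BTree.numNodes] at ha
    rw [length_interleave, List.map_map] at hlen
    simp only [mem_interleave] at hk
    intro x hx
    rw [BTree.words, List.mem_append, List.mem_flatMap] at hx
    rcases hx with hx | ⟨⟨t, a'⟩, ht, hx⟩
    · refine lt_of_mem_btreeBlock hV (by omega) (fun i hi => hk i (Or.inr hi)) hc ?_ x hx
      intro y hy
      have := lt_of_mem_childAddrs hy
      omega
    · obtain ⟨h1, h2⟩ := childAddrs_bound ht
      refine ih (t := t) (a := a') (fun i hi => hk i (Or.inl ⟨_, List.mem_map_of_mem h1, hi⟩))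
        ?_ (by omega) x hx
      have : (List.length ∘ BTree.inorder h) t ≤ (cs.map (List.length ∘ BTree.inorder h)).sum :=
        List.single_le_sum (by simp) _ (List.mem_map_of_mem h1)
      simp only [Function.comp] at this
      omega

/-! ### Total number of words and their values -/

theorem Memory.Represents.length_words_le {M : Memory} {w m ρ α : ℕ} {D out : DBWT}
    (h : M.Represents w m ρ α D) (hm : 3 ≤ m) (hout : out.length ≤ 2 * D.length) :
    (M.words m D out).length ≤ (28 + 4 * m) * D.length + (2 + 4 * m + ρ) := by
  have h1 : M.heavyU.length ≤ D.length := by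
    rw [h.heavyU.length_eq]
    simpa using List.length_filter_le _ (List.range D.length)
  have h2 : M.heavyV.length ≤ D.length := by
    rw [h.heavyV.length_eq]
    simpa using List.length_filter_le _ (List.range D.length)
  have h3 := h.order.length_words_le
  have h4 : BTree.numNodes M.height M.btree ≤ D.length + 1 := by
    have h5 := h.btree.numNodes_le hm
    have h6 := h.keys.length_le
    rw [length_vOrder] at h6
    simp only [if_true] at h5
    omega
  have h5 := Nat.mul_le_mul_left (4 * m) h4
  have h6 : (out.flatMap fun x => [x.1, x.2]).length = 2 * out.length := by
    clear hout
    induction out with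
    | nil => rfl
    | cons x out ih => rw [List.flatMap_cons, List.length_append, ih]; simp; omega
  have h7 := h.regs.1
  rw [Memory.words]
  simp only [List.length_append, List.length_cons, length_graphWords, h6, h.btree.length_words]
  -- The coefficient `28` is `14` for the graph, `2` for the heavy arrays, `8` for the order
  -- structure and `4` for the output of at most `2 * D.length` pairs. The B-tree has at most
  -- `D.length + 1` blocks of `4 * m` words.
  nlinarith

theorem Memory.Represents.lt_of_mem_words {M : Memory} {w m ρ α : ℕ} {D out : DBWT}
    (h : M.Represents w m ρ α D) (hm : 3 ≤ m) (hD : Pos D) (hs : size D + 1 < 2 ^ w)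
    (hc : ∀ x ∈ D, x.1 < 2 ^ w) (hout : ∀ x ∈ out, x.1 < 2 ^ w ∧ x.2 < 2 ^ w) :
    ∀ x ∈ M.words m D out, x < 2 ^ w := by
  have hk := length_le_size hD
  have hU : ∀ x ∈ M.heavyU, x < D.length := by
    intro x hx
    rw [h.heavyU.mem_iff] at hx
    exact List.mem_range.1 (List.mem_filter.1 hx).1
  have hV : ∀ x ∈ M.heavyV, x < D.length := by
    intro x hx
    rw [h.heavyV.mem_iff] at hx
    exact List.mem_range.1 (List.mem_filter.1 hx).1
  have h1 : M.heavyU.length ≤ D.length := by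
    rw [h.heavyU.length_eq]
    simpa using List.length_filter_le _ (List.range D.length)
  have h2 : M.heavyV.length ≤ D.length := by
    rw [h.heavyV.length_eq]
    simpa using List.length_filter_le _ (List.range D.length)
  have h6 := h.keys.length_le
  rw [length_vOrder] at h6
  have h5 := h.btree.numNodes_le hm
  simp only [if_true] at h5
  intro x hx
  simp only [Memory.words, List.mem_append, List.mem_cons] at hx
  rcases hx with (((((hx | hx | hx) | hx | hx) | hx) | hx) | hx) | hx
  · exact lt_of_mem_graphWords hD (by omega) hc x hx
  · omega
  · have := hU x hx
    omega
  · omega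
  · have := hV x hx
    omega
  · exact h.order.lt_of_mem_words (by omega) x hx
  · refine BTree.lt_of_mem_words (by positivity) (char_lt (by positivity) hc) ?_ (by omega)
      (by omega) x hx
    intro i hi
    have := mem_vOrder.1 (h.keys.subset hi)
    omega
  · exact h.regs.2 x hx
  · rw [List.mem_flatMap] at hx
    obtain ⟨y, hy, hx⟩ := hx
    simp only [List.mem_cons, List.not_mem_nil, or_false] at hx
    rcases hx with rfl | rfl
    · exact (hout y hy).1
    · exact (hout y hy).2

theorem pow_le_two_pow {n K w : ℕ} (hn : 2 ≤ n) (h : (K : ℝ) * Real.logb 2 n ≤ w) :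
    n ^ K ≤ 2 ^ w := by
  have hn0 : (0 : ℝ) < n := by positivity
  have h1 : (n : ℝ) = (2 : ℝ) ^ Real.logb 2 n :=
    (Real.rpow_logb (by norm_num) (by norm_num) hn0).symm
  have h2 : ((n : ℝ)) ^ K ≤ (2 : ℝ) ^ w := by
    rw [← Real.rpow_natCast, ← Real.rpow_natCast]
    conv_lhs => rw [h1]
    rw [← Real.rpow_mul (by norm_num), mul_comm]
    exact Real.rpow_le_rpow_of_exponent_le (by norm_num) h
  exact_mod_cast h2

theorem Visits.working_space {α w m ρ κ d : ℕ} {T : List ℕ} {D out : DBWT} {M : Memory}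
    (hα : 16 ≤ α) (hT : IsText T) (hn : 2 ≤ T.length) (hd : ∀ c ∈ T, c ≤ T.length ^ d)
    (hm : 3 ≤ m) (hw : ((d + 3 : ℕ) : ℝ) * Real.logb 2 T.length ≤ w)
    (hw' : (w : ℝ) ≤ κ * Real.logb 2 T.length) (hv : Visits α T D out)
    (hM : M.Represents w m ρ α D) :
    (∀ x ∈ M.words m D out, x < 2 ^ w) ∧
      (M.bits w m D out : ℝ) ≤ ((((28 + 4 * m) * 28 + (2 + 4 * m + ρ)) * κ : ℕ) : ℝ) *
        numRuns T * Real.logb 2 T.length := by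
  obtain ⟨hB, hout⟩ := hv.bounded hα hT
  have hpow := pow_le_two_pow hn hw
  -- Characters need the exponent `d`. Pointers, offsets and addresses are at most `n + 1`, which is
  -- below `n ^ 3` for `n ≥ 2`. The exponent `d + 3` covers both.
  have h3 : T.length + 1 < T.length ^ (d + 3) := by
    calc T.length + 1 < T.length ^ 3 := by
          generalize T.length = n at hn
          nlinarith [Nat.mul_le_mul hn hn, Nat.mul_le_mul hn (Nat.mul_le_mul hn hn)]
      _ ≤ T.length ^ (d + 3) := Nat.pow_le_pow_right (by omega) (by omega)
  have h4 : ∀ c ∈ T, c < 2 ^ w := fun c hc =>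
    ((hd c hc).trans_lt (Nat.pow_lt_pow_right (by omega) (by omega))).trans_le hpow
  have hsize := hB.size_le
  constructor
  · refine hM.lt_of_mem_words hm hB.pos (by omega) (fun x hx => h4 _ (hB.mem x hx)) ?_
    have hDx : ∀ x ∈ D, x.1 < 2 ^ w ∧ x.2 < 2 ^ w := fun x hx =>
      ⟨h4 _ (hB.mem x hx), by have := snd_le_size hx; omega⟩
    rcases hout with rfl | rfl | rfl
    · simp
    · exact hDx
    · intro x hx
      rcases List.mem_append.1 hx with hx | hx
      · exact hDx x hx
      · refine ⟨?_, ?_⟩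
        · obtain ⟨y, hy, he⟩ := List.mem_map.1 (fst_mem_of_mem_compress hx)
          rw [← he]
          exact (hDx y hy).1
        · have := snd_le_size hx
          rw [size_compress] at this
          omega
  · have hlen : out.length ≤ 2 * D.length := by
      rcases hout with rfl | rfl | rfl
      · simp
      · omega
      · have := length_compress_le D
        rw [List.length_append]
        omega
    -- Positivity turns the additive constant number of words into a multiple of the number of runs.
    have hr := numRuns_pos hT
    have h5 : (M.words m D out).length ≤ ((28 + 4 * m) * 28 + (2 + 4 * m + ρ)) * numRuns T :=
      calc (M.words m D out).length
          ≤ (28 + 4 * m) * D.length + (2 + 4 * m + ρ) := hM.length_words_le hm hlen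
        _ ≤ (28 + 4 * m) * (28 * numRuns T) + (2 + 4 * m + ρ) * numRuns T :=
            Nat.add_le_add (Nat.mul_le_mul_left _ hB.length_le) (Nat.le_mul_of_pos_right _ hr)
        _ = _ := by ring
    have h6 : ((M.words m D out).length : ℝ) ≤
        (((28 + 4 * m) * 28 + (2 + 4 * m + ρ) : ℕ) : ℝ) * numRuns T := by exact_mod_cast h5
    rw [Memory.bits, Nat.cast_mul]
    calc ((M.words m D out).length : ℝ) * w
        ≤ ((((28 + 4 * m) * 28 + (2 + 4 * m + ρ) : ℕ) : ℝ) * numRuns T) *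
            (κ * Real.logb 2 T.length) := mul_le_mul h6 hw' (by positivity) (by positivity)
      _ = _ := by push_cast; ring

end RComp

theorem mainTheorem2 :
    (∃ C₀ : ℕ, ∀ (α : ℕ) (T : List ℕ), 16 ≤ α → RComp.IsText T →
      ∀ (D : RComp.DBWT) (b : Bool), RComp.Run α T T.length D b →
        D.length ≤ C₀ * RComp.numRuns T) ∧
    (∀ d : ℕ, ∃ K : ℕ, ∀ m ρ κ : ℕ, 3 ≤ m → ∃ C : ℕ,
      ∀ (α w : ℕ) (T : List ℕ), 16 ≤ α → RComp.IsText T → 2 ≤ T.length →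
        (∀ c ∈ T, c ≤ T.length ^ d) →
        (K : ℝ) * Real.logb 2 T.length ≤ w → (w : ℝ) ≤ κ * Real.logb 2 T.length →
        ∀ (D out : RComp.DBWT) (M : RComp.Memory), RComp.Visits α T D out →
          M.Represents w m ρ α D →
          (∀ x ∈ M.words m D out, x < 2 ^ w) ∧
          (M.bits w m D out : ℝ) ≤ C * RComp.numRuns T * Real.logb 2 T.length) := by
  refine ⟨⟨26, fun α T hα hT D b h => h.length_le hα hT⟩, fun d => ⟨d + 3, fun m ρ κ hm => ?_⟩⟩
  exact ⟨((28 + 4 * m) * 28 + (2 + 4 * m + ρ)) * κ,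
    fun α w T hα hT hn hd hw hw' D out M hv hM => hv.working_space hα hT hn hd hm hw hw' hM⟩
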